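/- **Conventions.** A (virtual knot) diagram is given by its signed, oriented Gauss code: a finite cyclic sequence in which each of $n \ge 0$ crossings occurs exactly twice, once as an over-crossing ($O$) and once as an under-crossing ($U$), both times with the same sign $\pm$; arbitrary such codes are allowed. A virtual knot $K$ is an equivalence class of Gauss codes under renumbering of the crossings and the (oriented) Reidemeister moves I, II, III; the codes in the class are the diagrams of $K$. $K$ is classical if it has a diagram without virtual crossings, that is, a diagram whose Gauss code is that of a knot diagram in the plane (equivalently, the oriented surface determined by the signed code is a sphere; the code with $n=0$ is planar). A crossing of a diagram is odd if the number of terms of the Gauss code between its two occurrences is odd, and even otherwise. Let $\Lambda=\mathbb{Z}[s^{\pm1},t^{\pm1},z^{\pm1}]$ and $$B=\begin{pmatrix}0&s\\ t&1-st\end{pmatrix},\quad P_1=B,\quad P_2=\begin{pmatrix}0&s\\ t&st-1\end{pmatrix},\quad P_3=\begin{pmatrix}0&z\\ z^{-1}&0\end{pmatrix}.$$ Let $D$ be a diagram with $n\ge 1$ crossings and $P\in\{P_1,P_2,P_3\}$. The $2n$ arcs of $D$ are the segments of the code between consecutive terms. At a crossing let $u,o$ be the incoming under- and over-arcs and $u',o'$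 the outgoing ones, and let $Q=B$ if the crossing is even and $Q=P$ if it is odd. The crossing gives the two relations $$\begin{pmatrix}o'\\u'\end{pmatrix}=Q\begin{pmatrix}u\\o\end{pmatrix}\ \text{(positive crossing)},\qquad \begin{pmatrix}u'\\o'\end{pmatrix}=Q^{-1}\begin{pmatrix}o\\u\end{pmatrix}\ \text{(negative crossing)}.$$ Altogether each arc is expressed by a linear combination of arcs, $x = Mx$ with $M$ a $2n\times 2n$ matrix over $\Lambda$, and the polynomial of $D$ for the Parity Alexander Biquandle $(X,B,P)$ is $\Delta_P(D)=\det(M-I)$. For $n=0$ put $\Delta_P(D)=0$. The z-Parity Alexander polynomial is $\Delta_{P_3}(D)$; the Sawollek polynomial is $\Delta_{B}(D)$ (the map $B$ is used at all crossings). These polynomials are compared up to multiplication by monomials $s^it^j$, $i,j\in\mathbb{Z}$. **Theorem.** Let $K$ be a virtual knot. 1. If $P\in\{P_1,P_2,P_3\}$ and $\Delta_P(D)\neq 0$ for some diagram $D$ of $K$, then $K$ is not classical. 2. If the z-Parity Alexander polynomial of $K$ differs from the Sawollek polynomial of $K$, then every diagram of $K$ has an odd crossing. More precisely: if there are diagrams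 $D_1,D_2$ of $K$ such that $\Delta_{P_3}(D_1)\neq s^it^j\,\Delta_B(D_2)$ for all $i,j\in\mathbb{Z}$, then every diagram of $K$ has an odd crossing. -/

import Mathlib

/-- One term of a signed, oriented Gauss code: the knot runs through the crossing number `label`
as the over strand (`isOver = true`) or as the under strand (`isOver = false`), and that crossing has
sign `sign`. -/
structure Passage where
  isOver : Bool
  label : ℕ
  sign : ℤˣ
deriving DecidableEq

/-- The other passage through the same crossing. -/
def Passage.opposite (p : Passage) : Passage := ⟨!p.isOver, p.label, p.sign⟩

/-- A signed, oriented Gauss code, read from a base point: every crossing that occurs, occurs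
exactly twice, once over and once under, with the same sign.  The empty code is the circle
without crossings.  Arbitrary Gauss codes are allowed: these are the diagrams of virtual knots,
up to the virtual and mixed moves, which do not change the code. -/
structure GaussCode where
  passages : List Passage
  nodup : passages.Nodup
  opposite_mem : ∀ p ∈ passages, p.opposite ∈ passages
  eq_or_eq_opposite : ∀ p ∈ passages, ∀ q ∈ passages, p.label = q.label →
    q = p ∨ q = p.opposite

/-- The list `[x, y]` if `o = 1` and `[y, x]` if `o = -1`. -/
def orderedPair (o : ℤˣ) (x y : Passage) : List Passage := if o = 1 then [x, y] else [y, x]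

/-- The Reidemeister moves on Gauss codes, together with the change of base point and the
renumbering of the crossings.

In the third move the top strand runs over the middle strand (crossing `a`) and over the bottom
strand (crossing `b`), and the middle strand runs over the bottom strand (crossing `c`).
The number `α` is `1` if the top strand meets `a` before `b`, `β` is `1` if the middle strand
meets `a` before `c`, `γ` is `1` if the bottom strand meets `b` before `c`, and they are `-1`
otherwise.  The two equations between them and the signs of the crossings say exactly that the
strands can be drawn as three oriented lines in the plane which bound a triangle: for lines with
direction vectors `T`, `M`, `B`, the signs of `a`, `b`, `c` are those of the determinants `T × M`,
`T × B`, `M × B`, and `x T + y B = z M` with `x`, `y`, `z` of signs `α`, `γ`, `β`, by the three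
sides of the triangle.  All eight oriented triangles arise in this way.  The move reverses the
order of the two crossings on each of the three strands. -/
inductive ReidemeisterMove : List Passage → List Passage → Prop
  | basePoint (u v : List Passage) : ReidemeisterMove (u ++ v) (v ++ u)
  | renumber (f : Equiv.Perm ℕ) (u : List Passage) :
      ReidemeisterMove u (u.map fun p => ⟨p.isOver, f p.label, p.sign⟩)
  | one (o : Bool) (a : ℕ) (e : ℤˣ) (u : List Passage) :
      ReidemeisterMove u ([⟨o, a, e⟩, ⟨!o, a, e⟩] ++ u)
  | two (o : ℤˣ) (a b : ℕ) (e : ℤˣ) (u v : List Passage) :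
      ReidemeisterMove (u ++ v)
        ([⟨true, a, e⟩, ⟨true, b, -e⟩] ++ u ++ orderedPair o ⟨false, a, e⟩ ⟨false, b, -e⟩ ++ v)
  | three_top_mid_bot (a b c : ℕ) (ea eb ec α β γ : ℤˣ)
      (hβ : β = α * eb * ec) (hγ : γ = α * ea * ec) (u v w : List Passage) :
      ReidemeisterMove
        (orderedPair α ⟨true, a, ea⟩ ⟨true, b, eb⟩ ++ u ++
          orderedPair β ⟨false, a, ea⟩ ⟨true, c, ec⟩ ++ v ++
          orderedPair γ ⟨false, b, eb⟩ ⟨false, c, ec⟩ ++ w)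
        (orderedPair (-α) ⟨true, a, ea⟩ ⟨true, b, eb⟩ ++ u ++
          orderedPair (-β) ⟨false, a, ea⟩ ⟨true, c, ec⟩ ++ v ++
          orderedPair (-γ) ⟨false, b, eb⟩ ⟨false, c, ec⟩ ++ w)
  | three_top_bot_mid (a b c : ℕ) (ea eb ec α β γ : ℤˣ)
      (hβ : β = α * eb * ec) (hγ : γ = α * ea * ec) (u v w : List Passage) :
      ReidemeisterMove
        (orderedPair α ⟨true, a, ea⟩ ⟨true, b, eb⟩ ++ u ++
          orderedPair γ ⟨false, b, eb⟩ ⟨false, c, ec⟩ ++ v ++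
          orderedPair β ⟨false, a, ea⟩ ⟨true, c, ec⟩ ++ w)
        (orderedPair (-α) ⟨true, a, ea⟩ ⟨true, b, eb⟩ ++ u ++
          orderedPair (-γ) ⟨false, b, eb⟩ ⟨false, c, ec⟩ ++ v ++
          orderedPair (-β) ⟨false, a, ea⟩ ⟨true, c, ec⟩ ++ w)

/-- A virtual knot: a class of Gauss codes under the equivalence relation generated by the
Reidemeister moves (`Quot` passes to the generated equivalence relation). -/
def VirtualKnot : Type :=
  Quot fun D D' : GaussCode => ReidemeisterMove D.passages D'.passages

namespace GaussCode

/-- The virtual knot represented by a Gauss code; `D` is a diagram of `K` if `D.knot = K`. -/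
def knot (D : GaussCode) : VirtualKnot := Quot.mk _ D

/-- The arcs of a diagram: the arc `p` leads from the passage `p` to the next passage. -/
abbrev Arc (D : GaussCode) : Type := {p : Passage // p ∈ D.passages}

/-- The passage at the end of the arc `p`, as the arc that leaves it. -/
def next (D : GaussCode) (p : D.Arc) : D.Arc :=
  ⟨D.passages.next p.1 p.2, List.next_mem _ _ _⟩

/-- The arc that leads into the passage `p`. -/
def prev (D : GaussCode) (p : D.Arc) : D.Arc :=
  ⟨D.passages.prev p.1 p.2, List.prev_mem _ _ _⟩

/-- The arc that leaves the crossing of `p` on its other strand. -/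
def opp (D : GaussCode) (p : D.Arc) : D.Arc :=
  ⟨p.1.opposite, D.opposite_mem p.1 p.2⟩

/-! ### Parity of crossings -/

/-- The number of terms of the Gauss code strictly between the two occurrences of the crossing
of `p`. -/
def termsBetween (D : GaussCode) (p : Passage) : ℕ :=
  max (D.passages.idxOf p) (D.passages.idxOf p.opposite) -
    min (D.passages.idxOf p) (D.passages.idxOf p.opposite) - 1

/-- The diagram has an odd crossing. -/
def HasOddCrossing (D : GaussCode) : Prop :=
  ∃ p ∈ D.passages, Odd (D.termsBetween p)

/-! ### Classical diagrams -/

/-- Whether the other strand crosses the strand of `p` from right to left. At a positive crossing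
the under strand crosses the over strand from right to left. -/
def crossedToLeft (D : GaussCode) (p : D.Arc) : Bool := p.1.isOver == decide (p.1.sign = 1)

/-- An oriented arc `(p, true)` (along the knot) or `(p, false)` (against it) is followed to its
end, where one turns left into an arc of the other strand of the crossing reached.  The orbits are
the boundaries of the faces of the oriented surface that the signed code determines. -/
def turnLeft (D : GaussCode) : D.Arc × Bool → D.Arc × Bool
  | (p, true) =>
      if D.crossedToLeft (D.next p) then (D.opp (D.next p), true)
      else (D.prev (D.opp (D.next p)), false)
  | (p, false) =>
      if D.crossedToLeft p then (D.prev (D.opp p), false)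
      else (D.opp p, true)

/-- The faces of the closed oriented surface in which the code has a cellular diagram without
virtual crossings. -/
def Face (D : GaussCode) : Type := Quot fun d e : D.Arc × Bool => D.turnLeft d = e

/-- The code is that of a knot diagram in the plane (or sphere) without virtual crossings: there
is no crossing, or the (connected) surface above has Euler characteristic
`V - E + F = n - 2 n + F = 2`, where `2 n` is the length of the code. -/
def IsPlanar (D : GaussCode) : Prop :=
  D.passages = [] ∨ 2 * Nat.card D.Face = D.passages.length + 4

end GaussCode

/-- A virtual knot is classical if it has a diagram without virtual crossings. -/
def VirtualKnot.IsClassical (K : VirtualKnot) : Prop :=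
  ∃ D : GaussCode, D.knot = K ∧ D.IsPlanar

/-! ### The polynomials -/

namespace GaussCode

/-- The linear map used at a passage: `B` at even and `P` at odd crossings, and its inverse at
negative crossings. -/
noncomputable def crossingMap {R : Type*} [CommRing R] (D : GaussCode)
    (B P : Matrix (Fin 2) (Fin 2) R) (p : D.Arc) : Matrix (Fin 2) (Fin 2) R :=
  let Q := if Odd (D.termsBetween p.1) then P else B
  if p.1.sign = 1 then Q else Q⁻¹

/-- The component of the input which belongs to the strand of `p`.  The map `Q` of a positive
crossing sends the labels `(under, over)` of the incoming arcs to the labels `(over, under)` of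
the outgoing arcs; the map `Q⁻¹` of a negative crossing sends `(over, under)` to
`(under, over)`. -/
def inputIndex (D : GaussCode) (p : D.Arc) : Fin 2 :=
  if D.crossedToLeft p then 1 else 0

/-- The component of the output which belongs to the strand of `p`: the other one. -/
def outputIndex (D : GaussCode) (p : D.Arc) : Fin 2 :=
  if D.crossedToLeft p then 0 else 1

/-- The square matrix of relations of the parity biquandle `(X, B, P)` with `B` and `P` linear.
The row of `p` is the relation which expresses the arc leaving the passage `p` by the two arcs
that lead into its crossing, all terms being brought to one side; the columns are the
generators, that is, the arcs. -/
noncomputable def relationMatrix {R : Type*} [CommRing R] (D : GaussCode)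
    (B P : Matrix (Fin 2) (Fin 2) R) : Matrix D.Arc D.Arc R :=
  fun p x =>
    (if x = D.prev p then D.crossingMap B P p (D.outputIndex p) (D.inputIndex p) else 0) +
    (if x = D.prev (D.opp p) then
      D.crossingMap B P p (D.outputIndex p) (D.outputIndex p) else 0) -
    (if x = p then 1 else 0)

/-- The determinant of the matrix of relations.  A circle without crossings has one arc `a` and
only the relation `a = a`, hence the determinant `0`. -/
noncomputable def polynomial {R : Type*} [CommRing R] (D : GaussCode)
    (B P : Matrix (Fin 2) (Fin 2) R) : R :=
  if D.passages = [] then 0 else (D.relationMatrix B P).det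

end GaussCode

/-- The ring `ℤ[s, s⁻¹, t, t⁻¹, z, z⁻¹]`. -/
abbrev Laurent : Type := AddMonoidAlgebra ℤ (ℤ × ℤ × ℤ)

/-- The monomial `s ^ i * t ^ j * z ^ k`. -/
noncomputable def Laurent.monomial (i j k : ℤ) : Laurent := AddMonoidAlgebra.single (i, j, k) 1

noncomputable def Laurent.s : Laurent := Laurent.monomial 1 0 0

noncomputable def Laurent.t : Laurent := Laurent.monomial 0 1 0

/-- Equality up to a factor `s ^ i * t ^ j`. -/
def Laurent.EqUpToUnit (f g : Laurent) : Prop := ∃ i j : ℤ, f = Laurent.monomial i j 0 * g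

namespace ParityAlexander

/-- The Generalized Alexander Biquandle. -/
noncomputable def B : Matrix (Fin 2) (Fin 2) Laurent :=
  !![0, Laurent.s; Laurent.t, 1 - Laurent.s * Laurent.t]

/-- The odd map of the Even Parity Alexander Biquandle. -/
noncomputable def P₁ : Matrix (Fin 2) (Fin 2) Laurent := B

noncomputable def P₂ : Matrix (Fin 2) (Fin 2) Laurent :=
  !![0, Laurent.s; Laurent.t, Laurent.s * Laurent.t - 1]

/-- The odd map of the z-Parity Alexander Biquandle. -/
noncomputable def P₃ : Matrix (Fin 2) (Fin 2) Laurent :=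
  !![0, Laurent.monomial 0 0 1; Laurent.monomial 0 0 (-1), 0]

end ParityAlexander

namespace GaussCode

/-- The polynomial associated to the Parity Alexander Biquandle `(X, B, P)`, computed from the
diagram `D`. -/
noncomputable def parityPolynomial (D : GaussCode) (P : Matrix (Fin 2) (Fin 2) Laurent) :
    Laurent :=
  D.polynomial ParityAlexander.B P

/-- The Sawollek polynomial: the map `B` is used at all crossings. -/
noncomputable def sawollekPolynomial (D : GaussCode) : Laurent :=
  D.polynomial ParityAlexander.B ParityAlexander.B

end GaussCode

/-! ### Determinants of cyclic linear systems -/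

/-! The polynomial is an invariant of the virtual knot up to powers of `s t`, and it vanishes on
planar diagrams.

Invariance. The crossings determine coefficients `passageCoeff` between passages, and the order of
the code enters the matrix of relations only through the fact that the arc `x` leads into the
passage `next x`. So the polynomial is a `cyclicDet` (`polynomial_eq`), and the moves I, II, III
reduce to one operation: the arc between two consecutive passages is eliminated by a Schur
complement (`cyclicDet_cons_cons`). For move I the pivot is, up to sign, a power of `s t`, the only
factor that ever appears. For move II the two crossings cancel. For move III the three sides of the
triangle are eliminated before and after the move; what remains on the three strands is a triangular
map on either side, and `Compatible` makes the two maps equal (`mergeThree_threeCoeff`). Parity fits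
in because the crossing of move I is even, the two crossings of move II have equal parity, and among
those of move III none or two are odd (`weight_three`). The crossings outside a move keep their
parity. Hence only the cases listed in `IsParityPair` are needed, and `P₁`, `P₂`, `P₃` satisfy them.

Vanishing. In a planar diagram Euler characteristic 2 forces every rational 1-cycle to be a
boundary. The knot itself is a 1-cycle, so the faces can be numbered with the number on the right of
each arc one larger than on the left (`exists_isNumbering`). Along the knot the numbers change by
one at every passage, which makes all crossings even; and the vector with entries `s ^ n` lies in
the kernel of the matrix of relations, so the determinant is zero
(`IsNumbering.polynomial_eq_zero`).

The second claim follows from invariance alone: on a diagram without odd crossings the map `P` is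
never used, so the z-parity and the Sawollek polynomials coincide there. -/

theorem List.nextOr_change_default {ι : Type*} [DecidableEq ι] (l : List ι) (x d d' : ι)
    (hd : d ∉ l) :
    l.nextOr x d' = if l.nextOr x d = d then d' else l.nextOr x d := by
  induction l with
  | nil => simp
  | cons y t ih =>
    cases t with
    | nil => simp
    | cons z t =>
      by_cases hx : x = y
      · subst hx
        have : z ≠ d := fun h => hd (by simp [h])
        simp [this]
      · rw [List.nextOr_cons_of_ne _ _ _ _ hx, List.nextOr_cons_of_ne _ _ _ _ hx]
        exact ih fun h => hd (List.mem_cons_of_mem _ h)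

/-- When `p` is deleted from the cycle, its predecessor is followed by `q`, and all other successors
stay. -/
theorem List.next_tail {ι : Type*} [DecidableEq ι] {p q : ι} {t : List ι}
    (hn : (p :: q :: t).Nodup) (x : ι) (hx : x ∈ q :: t) :
    (q :: t).next x hx = if (p :: q :: t).next x (List.mem_cons_of_mem _ hx) = p then q
      else (p :: q :: t).next x (List.mem_cons_of_mem _ hx) := by
  have hp : p ∉ q :: t := (List.nodup_cons.1 hn).1
  have hxp : x ≠ p := fun h => hp (h ▸ hx)
  have h1 : (p :: q :: t).next x (List.mem_cons_of_mem _ hx) = (q :: t).nextOr x p := by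
    simp only [List.next, List.get]
    rw [List.nextOr_cons_of_ne _ _ _ _ hxp]
  rw [h1]
  exact List.nextOr_change_default (q :: t) x p q hp

theorem List.next_injective {ι : Type*} [DecidableEq ι] {l : List ι} (hn : l.Nodup) {x y : ι}
    (hx : x ∈ l) (hy : y ∈ l) (h : l.next x hx = l.next y hy) : x = y := by
  rw [← List.prev_next l hn x hx, ← List.prev_next l hn y hy]
  congr 1

theorem List.next_map {ι κ : Type*} [DecidableEq ι] [DecidableEq κ] {f : ι → κ}
    (hf : Function.Injective f) {l : List ι} (hn : l.Nodup) (x : ι) (hx : x ∈ l)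
    (hx' : f x ∈ l.map f) : (l.map f).next (f x) hx' = f (l.next x hx) := by
  obtain ⟨i, hi, rfl⟩ := List.getElem_of_mem hx
  have h := List.next_getElem (l.map f) (hn.map hf) i (by simpa using hi)
  simp only [List.getElem_map, List.length_map] at h
  rw [h, List.next_getElem l hn i hi]

section CyclicSystem

variable {ι κ R : Type*} [DecidableEq ι] [DecidableEq κ] [CommRing R]

/-- The matrix of the linear system whose unknowns are the arcs between consecutive items of the
cyclic list `l`.  The row of `p` expresses the arc that leaves `p`, the coefficient of the arc that
leads into `y` being `K p y`. -/
def cyclicMatrix (l : List ι) (K : ι → ι → R) : Matrix {x // x ∈ l} {x // x ∈ l} R :=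
  fun p x => K p (l.next x x.2) - if p = x then 1 else 0

/-- The determinant of a cyclic linear system, which is `0` for the empty list. -/
def cyclicDet (l : List ι) (K : ι → ι → R) : R :=
  if l = [] then 0 else (cyclicMatrix l K).det

theorem cyclicDet_congr {l : List ι} {K K' : ι → ι → R}
    (h : ∀ p ∈ l, ∀ y ∈ l, K p y = K' p y) : cyclicDet l K = cyclicDet l K' := by
  unfold cyclicDet
  congr 2
  ext p x
  simp only [cyclicMatrix]
  rw [h p p.2 _ (List.next_mem l x x.2)]

theorem cyclicDet_rotate {l l' : List ι} (hn : l.Nodup) (h : l ~r l') (K : ι → ι → R) :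
    cyclicDet l K = cyclicDet l' K := by
  unfold cyclicDet
  have he : l = [] ↔ l' = [] := by
    constructor
    · rintro rfl; simpa using h.symm
    · rintro rfl; simpa using h
  simp only [he]
  congr 1
  let e : {x // x ∈ l} ≃ {x // x ∈ l'} := Equiv.subtypeEquivRight fun x => h.mem_iff
  rw [← Matrix.det_submatrix_equiv_self e (cyclicMatrix l' K)]
  congr 1
  ext p x
  simp only [cyclicMatrix, Matrix.submatrix_apply, e, Equiv.subtypeEquivRight_apply]
  rw [List.isRotated_next_eq h hn x.2]
  simp [Subtype.ext_iff]

theorem cyclicDet_append_comm {u v : List ι} (hn : (u ++ v).Nodup) (K : ι → ι → R) :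
    cyclicDet (u ++ v) K = cyclicDet (v ++ u) K :=
  cyclicDet_rotate hn List.isRotated_append K

theorem cyclicDet_map {f : ι → κ} (hf : Function.Injective f) {l : List ι} (hn : l.Nodup)
    (K : κ → κ → R) : cyclicDet (l.map f) K = cyclicDet l fun p y => K (f p) (f y) := by
  unfold cyclicDet
  simp only [List.map_eq_nil_iff]
  congr 1
  let e : {x // x ∈ l} ≃ {x // x ∈ l.map f} :=
    Equiv.ofBijective (fun x => ⟨f x, List.mem_map_of_mem x.2⟩) (by
      constructor
      · intro x y h
        exact Subtype.ext (hf (congrArg Subtype.val h))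
      · rintro ⟨y, hy⟩
        obtain ⟨x, hx, rfl⟩ := List.mem_map.1 hy
        exact ⟨⟨x, hx⟩, rfl⟩)
  rw [← Matrix.det_submatrix_equiv_self e]
  congr 1
  ext p x
  have hex : e p = e x ↔ p = x := e.injective.eq_iff
  have hnx : (l.map f).next (e x) (e x).2 = f (l.next x x.2) := List.next_map hf hn x x.2 _
  change K (f p) ((l.map f).next (e x) (e x).2) - (if e p = e x then 1 else 0) = _
  simp only [hnx, hex, cyclicMatrix]

/-- The coefficients after the elimination of the arc from `p` to `q`, where `d⁻¹ K p` is the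
expression for this arc; the two items become one item with the name `q`. -/
def mergeCoeff (p q : ι) (c : R) (K : ι → ι → R) (r y : ι) : R :=
  K r (if y = q then p else y) + K r q * c * K p (if y = q then p else y)

/-- Schur complement for the row and the column of `p`. The arc leaving `p` leads into `q`, so the
diagonal entry is `K p q - 1 = -d`, an invertible pivot. -/
theorem cyclicDet_cons_cons {p q : ι} {t : List ι} (hn : (p :: q :: t).Nodup) (d : Rˣ)
    (K : ι → ι → R) (hK : K p q = 1 - d) :
    cyclicDet (p :: q :: t) K = -d * cyclicDet (q :: t) (mergeCoeff p q ↑d⁻¹ K) := by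
  have hp : p ∉ q :: t := (List.nodup_cons.1 hn).1
  simp only [cyclicDet, reduceCtorEq, if_false]
  let e : Unit ⊕ {x // x ∈ q :: t} ≃ {x // x ∈ p :: q :: t} :=
    Equiv.ofBijective (Sum.elim (fun _ => ⟨p, List.mem_cons_self⟩)
      fun x => ⟨x, List.mem_cons_of_mem _ x.2⟩) (by
      constructor
      · rintro (x | x) (y | y) h
        · rfl
        · have h' : p = y := congrArg Subtype.val h
          exact absurd (h' ▸ y.2) hp
        · have h' : (x : ι) = p := congrArg Subtype.val h
          exact absurd (h' ▸ x.2) hp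
        · have h' : (x : ι) = y := congrArg (fun w => (w : {x // x ∈ p :: q :: t}).1) h
          exact congrArg Sum.inr (Subtype.ext h')
      · rintro ⟨y, hy⟩
        rcases List.mem_cons.1 hy with rfl | hy'
        · exact ⟨Sum.inl (), rfl⟩
        · exact ⟨Sum.inr ⟨y, hy'⟩, rfl⟩)
  let A : Matrix Unit Unit R := Matrix.of fun _ _ => -(d : R)
  let _ : Invertible A := ⟨Matrix.of fun _ _ => -((d⁻¹ : Rˣ) : R),
    by ext; simp [A, Matrix.mul_apply], by ext; simp [A, Matrix.mul_apply]⟩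
  have hpn : (p :: q :: t).next p List.mem_cons_self = q :=
    List.next_cons_cons_eq (l := t) (x := p) q List.mem_cons_self
  -- The merged item is called `q` but is entered through the former `p`. The renaming is
  -- unambiguous because only `p` had `q` as successor.
  have hnext : ∀ (x : ι) (hx : x ∈ q :: t),
      (if (q :: t).next x hx = q then p else (q :: t).next x hx) =
        (p :: q :: t).next x (List.mem_cons_of_mem _ hx) := by
    intro x hx
    have hq : (p :: q :: t).next x (List.mem_cons_of_mem _ hx) ≠ q := by
      intro h
      have := List.next_injective hn (List.mem_cons_of_mem _ hx) List.mem_cons_self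
        (h.trans hpn.symm)
      exact hp (this ▸ hx)
    rw [List.next_tail hn x hx]
    by_cases h1 : (p :: q :: t).next x (List.mem_cons_of_mem _ hx) = p
    · simp [h1]
    · simp [h1, hq]
  rw [← Matrix.det_submatrix_equiv_self e]
  have hblock : (cyclicMatrix (p :: q :: t) K).submatrix e e =
      Matrix.fromBlocks A
        (Matrix.of fun _ (x : {x // x ∈ q :: t}) => K p ((p :: q :: t).next x (List.mem_cons_of_mem _ x.2)))
        (Matrix.of fun (r : {x // x ∈ q :: t}) _ => K r q)
        (Matrix.of fun (r x : {x // x ∈ q :: t}) => K r ((p :: q :: t).next x (List.mem_cons_of_mem _ x.2)) -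
          if r = x then 1 else 0) := by
    ext (i | i) (j | j)
    · change K p ((p :: q :: t).next p _) - (if e (Sum.inl i) = e (Sum.inl j) then 1 else 0) = _
      rw [hpn]
      simp [hK, A]
    · change K p ((p :: q :: t).next j _) - (if e (Sum.inl i) = e (Sum.inr j) then 1 else 0) = _
      simp [e.injective.eq_iff]
    · change K i ((p :: q :: t).next p _) - (if e (Sum.inr i) = e (Sum.inl j) then 1 else 0) = _
      rw [hpn]
      simp [e.injective.eq_iff]
    · change K i ((p :: q :: t).next j _) - (if e (Sum.inr i) = e (Sum.inr j) then 1 else 0) = _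
      simp [e.injective.eq_iff]
  rw [hblock, Matrix.det_fromBlocks₁₁]
  congr 1
  · simp [A]
  · congr 1
    ext r x
    simp only [Matrix.sub_apply, Matrix.of_apply, cyclicMatrix, mergeCoeff, hnext,
      Matrix.mul_apply, Finset.univ_unique, Finset.sum_singleton]
    have : (⅟A) default default = -((d⁻¹ : Rˣ) : R) := rfl
    simp only [PUnit.default_eq_unit] at *
    rw [this]
    ring

theorem cyclicDet_merge {p q : ι} {u v : List ι} (hn : (u ++ [p, q] ++ v).Nodup) (d : Rˣ)
    (K : ι → ι → R) (hK : K p q = 1 - d) :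
    cyclicDet (u ++ [p, q] ++ v) K = -d * cyclicDet (u ++ [q] ++ v) (mergeCoeff p q ↑d⁻¹ K) := by
  have h1 : (u ++ [p, q] ++ v) ~r (p :: q :: (v ++ u)) := by
    have := List.isRotated_append (l := u) (l' := [p, q] ++ v)
    simpa using this
  have h2 : (q :: (v ++ u)) ~r (u ++ [q] ++ v) := by
    have := List.isRotated_append (l := [q] ++ v) (l' := u)
    simpa using this
  have hn' := h1.nodup_iff.1 hn
  rw [cyclicDet_rotate hn h1, cyclicDet_cons_cons hn' d K hK,
    cyclicDet_rotate (List.nodup_cons.1 hn').2 h2]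

/-- An item which only passes on the arc leading into it can be removed. -/
theorem cyclicDet_cons_of_pass {q : ι} {t : List ι} (hn : (q :: t).Nodup) (K : ι → ι → R)
    (hq : ∀ y ∈ q :: t, K q y = if y = q then 1 else 0) (ht : ∀ x ∈ t, K x q = 0) :
    cyclicDet (q :: t) K = -cyclicDet t K := by
  rcases List.eq_nil_or_concat t with rfl | ⟨t, z, rfl⟩
  -- A single passing item gives the 1×1 matrix `1 - 1 = 0`, in agreement with the value `0` for the
  -- empty list.
  · simp only [cyclicDet, reduceCtorEq, if_false, if_true, neg_zero]
    let _ : Unique {x // x ∈ [q]} := ⟨⟨⟨q, by simp⟩⟩, fun x => Subtype.ext (by simpa using x.2)⟩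
    rw [Matrix.det_unique]
    have : (default : {x // x ∈ [q]}) = ⟨q, by simp⟩ := rfl
    rw [this]
    simp [cyclicMatrix, hq]
  · have hzq : z ≠ q := by
      rintro rfl
      simp at hn
    have h1 : (q :: (t ++ [z])) ~r (z :: q :: t) := by
      have := List.isRotated_append (l := q :: t) (l' := [z])
      simpa using this
    have h2 : (z :: t) ~r (t ++ [z]) := by
      have := List.isRotated_append (l := [z]) (l' := t)
      simpa using this
    have hn1 := h1.nodup_iff.1 (by simpa using hn)
    have hn2 : (z :: t).Nodup := hn1.sublist (by simp)
    simp only [List.concat_eq_append] at *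
    rw [cyclicDet_rotate hn h1, ← cyclicDet_rotate hn2 h2,
      cyclicDet_cons_cons hn1 1 K (by simp [ht z])]
    simp only [Units.val_one, neg_mul, one_mul, inv_one]
    congr 1
    have hqt : q ∉ t := fun h => by simp [h] at hn
    -- Here `q` has been merged with its predecessor `z`, with pivot `-1`. The merged item bears the
    -- name `q`; the swap gives it back the name `z`.
    have hinj : Function.Injective (Equiv.swap q z) := (Equiv.swap q z).injective
    have hzt : z ∉ t := (List.nodup_cons.1 hn2).1
    have hfix : ∀ x ∈ t, Equiv.swap q z x = x := fun x hx =>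
      Equiv.swap_apply_of_ne_of_ne (fun h => hqt (by rwa [h] at hx))
        (fun h => hzt (by rwa [h] at hx))
    have hmap : q :: t = (z :: t).map (Equiv.swap q z) := by
      simp only [List.map_cons, Equiv.swap_apply_right, List.cons.injEq, true_and]
      conv_lhs => rw [← List.map_id t]
      refine List.map_congr_left fun x hx => ?_
      rw [hfix x hx]
      rfl
    rw [hmap, cyclicDet_map hinj hn2]
    have hsw : ∀ y ∈ z :: t, (if Equiv.swap q z y = q then z else Equiv.swap q z y) = y := by
      intro y hy
      rcases List.mem_cons.1 hy with rfl | hy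
      · simp
      · have h3 : y ≠ q := fun h => hqt (h ▸ hy)
        rw [hfix y hy, if_neg h3]
    refine cyclicDet_congr fun p hp y hy => ?_
    have hyq : y ≠ q := by
      rcases List.mem_cons.1 hy with rfl | hy
      · exact hzq
      · exact fun h => hqt (h ▸ hy)
    have hym : y ∈ q :: (t ++ [z]) := by
      rcases List.mem_cons.1 hy with rfl | hy <;> simp [*]
    simp only [mergeCoeff]
    rw [hsw y hy]
    rcases List.mem_cons.1 hp with rfl | hp
    · simp [hq, hym, hyq]
    · rw [hfix p hp]
      simp [ht p (by simp [hp])]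

theorem cyclicDet_of_pass {q : ι} {u v : List ι} (hn : (u ++ [q] ++ v).Nodup) (K : ι → ι → R)
    (hq : ∀ y ∈ u ++ [q] ++ v, K q y = if y = q then 1 else 0) (ht : ∀ x ∈ u ++ v, K x q = 0) :
    cyclicDet (u ++ [q] ++ v) K = -cyclicDet (u ++ v) K := by
  have h1 : (u ++ [q] ++ v) ~r (q :: (v ++ u)) := by
    have := List.isRotated_append (l := u) (l' := [q] ++ v)
    simpa using this
  have hn' := h1.nodup_iff.1 hn
  rw [cyclicDet_rotate hn h1, cyclicDet_cons_of_pass hn' K (fun y hy => hq y (h1.mem_iff.2 hy))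
    (fun x hx => ht x (by simp at hx ⊢; tauto)),
    cyclicDet_append_comm (List.nodup_cons.1 hn').2]

end CyclicSystem

/-! ### Elimination in blocks of interacting items -/

section Block

variable {ι κ R : Type*} [DecidableEq ι] [CommRing R]

theorem mergeCoeff_comp [DecidableEq κ] {φ : κ → ι} (hφ : Function.Injective φ) (p q : κ) (c : R)
    (K : ι → ι → R) (i j : κ) :
    mergeCoeff (φ p) (φ q) c K (φ i) (φ j) = mergeCoeff p q c (fun i j => K (φ i) (φ j)) i j := by
  simp only [mergeCoeff, hφ.eq_iff]
  split_ifs <;> rfl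

/-- The items `φ i` do not interact with the other items. -/
def IsBlock (φ : κ → ι) (K : ι → ι → R) : Prop :=
  ∀ x, x ∉ Set.range φ → ∀ i, K x (φ i) = 0 ∧ K (φ i) x = 0

theorem mergeCoeff_of_isBlock {φ : κ → ι} {K : ι → ι → R} (h : IsBlock φ K) (p q : κ) (c : R)
    {x : ι} (hx : x ∉ Set.range φ) {y : ι} (hy : y ∉ Set.range φ) :
    mergeCoeff (φ p) (φ q) c K x y = K x y := by
  have hyq : y ≠ φ q := fun h => hy ⟨q, h.symm⟩
  simp [mergeCoeff, hyq, (h x hx q).1]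

theorem IsBlock.mergeCoeff {φ : κ → ι} {K : ι → ι → R} (h : IsBlock φ K) (p q : κ) (c : R) :
    IsBlock φ (mergeCoeff (φ p) (φ q) c K) := by
  intro x hx i
  have hxq : x ≠ φ q := fun h => hx ⟨q, h.symm⟩
  simp only [_root_.mergeCoeff, (h x hx q).1, (h x hx p).2, if_neg hxq, (h x hx i).2]
  constructor
  · split_ifs
    · simp [(h x hx p).1]
    · simp [(h x hx i).1]
  · simp

theorem IsBlock.cyclicDet_congr {φ : κ → ι} {l : List ι} {K K' : ι → ι → R}
    (h : IsBlock φ K) (h' : IsBlock φ K')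
    (hφ : ∀ i j, φ i ∈ l → φ j ∈ l → K (φ i) (φ j) = K' (φ i) (φ j))
    (ho : ∀ x y, x ∉ Set.range φ → y ∉ Set.range φ → K x y = K' x y) :
    cyclicDet l K = cyclicDet l K' := by
  refine _root_.cyclicDet_congr fun p hp y hy => ?_
  by_cases hp' : p ∈ Set.range φ <;> by_cases hy' : y ∈ Set.range φ
  · obtain ⟨i, rfl⟩ := hp'
    obtain ⟨j, rfl⟩ := hy'
    exact hφ i j hp hy
  · obtain ⟨i, rfl⟩ := hp'
    rw [(h y hy' i).2, (h' y hy' i).2]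
  · obtain ⟨j, rfl⟩ := hy'
    rw [(h p hp' j).1, (h' p hp' j).1]
  · exact ho p y hp' hy'

/-- The coefficients in a block of three pairs of items after the elimination of the arcs inside
the pairs. -/
def mergeThree (k : Fin 6 → Fin 6 → R) : Fin 6 → Fin 6 → R :=
  mergeCoeff 4 5 1 (mergeCoeff 2 3 1 (mergeCoeff 0 1 1 k))

/-- The arcs inside the three pairs can be eliminated one after the other. -/
def IsTriangular (k : Fin 6 → Fin 6 → R) : Prop :=
  k 0 1 = 0 ∧ mergeCoeff 0 1 1 k 2 3 = 0 ∧ mergeCoeff 2 3 1 (mergeCoeff 0 1 1 k) 4 5 = 0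

/-- Two systems with the same list, which differ in a block of three pairs only, have the same
determinant if they agree after the elimination of the arcs inside the pairs. -/
theorem cyclicDet_eq_of_mergeThree_eq {φ : Fin 6 → ι} (hφ : Function.Injective φ)
    {K K' : ι → ι → R} (h : IsBlock φ K) (h' : IsBlock φ K')
    {l u₀ v₀ u₁ v₁ u₂ v₂ : List ι} (hn : l.Nodup)
    (h₀ : l = u₀ ++ [φ 0, φ 1] ++ v₀)
    (h₁ : u₀ ++ [φ 1] ++ v₀ = u₁ ++ [φ 2, φ 3] ++ v₁)
    (h₂ : u₁ ++ [φ 3] ++ v₁ = u₂ ++ [φ 4, φ 5] ++ v₂)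
    (ht : IsTriangular fun i j => K (φ i) (φ j)) (ht' : IsTriangular fun i j => K' (φ i) (φ j))
    (hm : ∀ i ∈ ({1, 3, 5} : Finset (Fin 6)), ∀ j ∈ ({1, 3, 5} : Finset (Fin 6)),
      mergeThree (fun i j => K (φ i) (φ j)) i j = mergeThree (fun i j => K' (φ i) (φ j)) i j)
    (ho : ∀ x y, x ∉ Set.range φ → y ∉ Set.range φ → K x y = K' x y) :
    cyclicDet l K = cyclicDet l K' := by
  have hn₁ : (u₀ ++ [φ 1] ++ v₀).Nodup := by
    rw [h₀] at hn
    exact hn.sublist (by simp)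
  have hn₂ : (u₁ ++ [φ 3] ++ v₁).Nodup := by
    rw [h₁] at hn₁
    exact hn₁.sublist (by simp)
  have hn₃ : (u₂ ++ [φ 5] ++ v₂).Nodup := by
    rw [h₂] at hn₂
    exact hn₂.sublist (by simp)
  have key : ∀ K : ι → ι → R, IsTriangular (fun i j => K (φ i) (φ j)) →
      cyclicDet l K = -cyclicDet (u₂ ++ [φ 5] ++ v₂)
        (mergeCoeff (φ 4) (φ 5) 1 (mergeCoeff (φ 2) (φ 3) 1 (mergeCoeff (φ 0) (φ 1) 1 K))) := by
    intro K ht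
    have e1 := mergeCoeff_comp hφ 0 1 (1 : R) K
    have e2 := mergeCoeff_comp hφ 2 3 (1 : R) (mergeCoeff (φ 0) (φ 1) 1 K)
    rw [h₀, cyclicDet_merge (h₀ ▸ hn) 1 K (by simpa using ht.1), h₁,
      cyclicDet_merge (h₁ ▸ hn₁) 1 _ (by
        rw [Units.val_one, inv_one, Units.val_one, e1, ht.2.1, sub_self]), h₂,
      cyclicDet_merge (h₂ ▸ hn₂) 1 _ (by
        simp only [Units.val_one, inv_one]
        rw [e2]
        simp only [e1]
        rw [sub_self]
        exact ht.2.2)]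
    simp
  rw [key K ht, key K' ht']
  congr 1
  -- Each merging keeps the name of the second item of its pair, so only the entries with indices 1,
  -- 3, 5 have to be compared.
  have hmem : ∀ i, φ i ∈ u₂ ++ [φ 5] ++ v₂ → i ∈ ({1, 3, 5} : Finset (Fin 6)) := by
    have n0 : φ 0 ∉ u₀ ++ [φ 1] ++ v₀ := by
      rw [h₀] at hn
      simp only [List.append_assoc, List.nodup_append, List.nodup_cons] at hn
      simp only [List.mem_append, List.mem_singleton, hφ.eq_iff]
      rintro ((hx | hx) | hx)
      · exact hn.2.2 _ hx _ (by simp) rfl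
      · exact absurd hx (by decide)
      · exact hn.2.1.2.2 _ (by simp) _ hx rfl
    have n2 : φ 2 ∉ u₁ ++ [φ 3] ++ v₁ := by
      rw [h₁] at hn₁
      simp only [List.append_assoc, List.nodup_append, List.nodup_cons] at hn₁
      simp only [List.mem_append, List.mem_singleton, hφ.eq_iff]
      rintro ((hx | hx) | hx)
      · exact hn₁.2.2 _ hx _ (by simp) rfl
      · exact absurd hx (by decide)
      · exact hn₁.2.1.2.2 _ (by simp) _ hx rfl
    have n4 : φ 4 ∉ u₂ ++ [φ 5] ++ v₂ := by
      rw [h₂] at hn₂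
      simp only [List.append_assoc, List.nodup_append, List.nodup_cons] at hn₂
      simp only [List.mem_append, List.mem_singleton, hφ.eq_iff]
      rintro ((hx | hx) | hx)
      · exact hn₂.2.2 _ hx _ (by simp) rfl
      · exact absurd hx (by decide)
      · exact hn₂.2.1.2.2 _ (by simp) _ hx rfl
    have s₂ : ∀ x ∈ u₂ ++ [φ 5] ++ v₂, x ∈ u₁ ++ [φ 3] ++ v₁ := by
      rw [h₂]
      intro x hx
      simp only [List.mem_append, List.mem_cons] at hx ⊢
      tauto
    have s₁ : ∀ x ∈ u₁ ++ [φ 3] ++ v₁, x ∈ u₀ ++ [φ 1] ++ v₀ := by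
      rw [h₁]
      intro x hx
      simp only [List.mem_append, List.mem_cons] at hx ⊢
      tauto
    intro i hi
    by_contra hc
    have : i = 0 ∨ i = 2 ∨ i = 4 := by
      revert hc
      clear hi
      revert i
      decide
    rcases this with rfl | rfl | rfl
    · exact n0 (s₁ _ (s₂ _ hi))
    · exact n2 (s₂ _ hi)
    · exact n4 hi
  refine IsBlock.cyclicDet_congr (φ := φ) (((h.mergeCoeff 0 1 1).mergeCoeff 2 3 1).mergeCoeff 4 5 1)
    (((h'.mergeCoeff 0 1 1).mergeCoeff 2 3 1).mergeCoeff 4 5 1) (fun i j hi hj => ?_)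
    fun x y hx hy => ?_
  · have := hm i (hmem i hi) j (hmem j hj)
    simp only [mergeCoeff_comp hφ]
    exact this
  · rw [mergeCoeff_of_isBlock ((h.mergeCoeff 0 1 1).mergeCoeff 2 3 1) 4 5 1 hx hy,
      mergeCoeff_of_isBlock (h.mergeCoeff 0 1 1) 2 3 1 hx hy,
      mergeCoeff_of_isBlock h 0 1 1 hx hy,
      mergeCoeff_of_isBlock ((h'.mergeCoeff 0 1 1).mergeCoeff 2 3 1) 4 5 1 hx hy,
      mergeCoeff_of_isBlock (h'.mergeCoeff 0 1 1) 2 3 1 hx hy,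
      mergeCoeff_of_isBlock h' 0 1 1 hx hy]
    exact ho x y hx hy

/-- The exchange of the items in each of three pairs. -/
def flipPairs : Fin 6 → Fin 6 := ![1, 0, 3, 2, 5, 4]

/-- The permutation which exchanges the items in each of three pairs. -/
def flipPerm (φ : Fin 6 → ι) : Equiv.Perm ι :=
  Equiv.swap (φ 0) (φ 1) * (Equiv.swap (φ 2) (φ 3) * Equiv.swap (φ 4) (φ 5))

theorem flipPerm_apply {φ : Fin 6 → ι} (hφ : Function.Injective φ) (i : Fin 6) :
    flipPerm φ (φ i) = φ (flipPairs i) := by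
  fin_cases i <;>
    simp [flipPerm, flipPairs, Equiv.swap_apply_def, hφ.eq_iff]

theorem flipPerm_of_notMem {φ : Fin 6 → ι} {x : ι} (hx : x ∉ Set.range φ) :
    flipPerm φ x = x := by
  have h : ∀ i, x ≠ φ i := fun i h => hx ⟨i, h.symm⟩
  simp [flipPerm, Equiv.swap_apply_def, h]

/-- Exchanging items in the list amounts to permuting the coefficients and leaving the list alone.
This turns a third move into a comparison of two systems on one list. -/
theorem cyclicDet_map_flipPerm {φ : Fin 6 → ι} (hφ : Function.Injective φ)
    {K : ι → ι → R} (h : IsBlock φ K)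
    {l u₀ v₀ u₁ v₁ u₂ v₂ : List ι} (hn : l.Nodup)
    (h₀ : l = u₀ ++ [φ 0, φ 1] ++ v₀)
    (h₁ : u₀ ++ [φ 1] ++ v₀ = u₁ ++ [φ 2, φ 3] ++ v₁)
    (h₂ : u₁ ++ [φ 3] ++ v₁ = u₂ ++ [φ 4, φ 5] ++ v₂)
    (ht : IsTriangular fun i j => K (φ i) (φ j))
    (ht' : IsTriangular fun i j => K (φ (flipPairs i)) (φ (flipPairs j)))
    (hm : ∀ i ∈ ({1, 3, 5} : Finset (Fin 6)), ∀ j ∈ ({1, 3, 5} : Finset (Fin 6)),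
      mergeThree (fun i j => K (φ i) (φ j)) i j =
        mergeThree (fun i j => K (φ (flipPairs i)) (φ (flipPairs j))) i j) :
    cyclicDet (l.map (flipPerm φ)) K = cyclicDet l K := by
  rw [cyclicDet_map (flipPerm φ).injective hn]
  refine (cyclicDet_eq_of_mergeThree_eq hφ h ?_ hn h₀ h₁ h₂ ht ?_ ?_ ?_).symm
  · intro x hx i
    simp only [flipPerm_of_notMem hx, flipPerm_apply hφ]
    exact h x hx _
  · simpa only [flipPerm_apply hφ] using ht'
  · simpa only [flipPerm_apply hφ] using hm
  · intro x y hx hy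
    rw [flipPerm_of_notMem hx, flipPerm_of_notMem hy]

end Block

/-! ### Linear crossings -/

/-- The entries of an invertible matrix `!![0, s; t, r]`, used as the map of a positive
crossing. -/
structure LinearCrossing (R : Type*) [CommRing R] where
  s : Rˣ
  t : Rˣ
  r : R

section LinearCrossing

variable {R : Type*} [CommRing R]

namespace LinearCrossing

/-- The coefficient of the incoming arc of the same strand. -/
def diag (c : LinearCrossing R) (o : Bool) (e : ℤˣ) : Rˣ :=
  if e = 1 then (if o then c.s else c.t) else (if o then c.s⁻¹ else c.t⁻¹)

/-- The coefficient of the incoming arc of the other strand. -/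
def mix (c : LinearCrossing R) (o : Bool) (e : ℤˣ) : R :=
  if o then 0 else if e = 1 then c.r else -c.r * ↑c.s⁻¹ * ↑c.t⁻¹

/-- The third Reidemeister move is possible for the crossings `a` of the top and the middle strand,
`b` of the top and the bottom strand, `c` of the middle and the bottom strand. -/
structure Compatible (a b c : LinearCrossing R) : Prop where
  top : a.r * c.s = a.r * b.s
  bot : c.r * a.t = c.r * b.t
  mid : b.r * (1 - c.t * a.s) = a.r * c.r

end LinearCrossing

/-- The coefficients of the system of relations of a Gauss code, the crossing with label `n`
having the map `W n`. -/
def passageCoeff (W : ℕ → LinearCrossing R) (p y : Passage) : R :=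
  (if y = p then ((W p.label).diag p.isOver p.sign : R) else 0) +
    if y = p.opposite then (W p.label).mix p.isOver p.sign else 0

theorem passageCoeff_of_label_ne (W : ℕ → LinearCrossing R) {p y : Passage}
    (h : y.label ≠ p.label) : passageCoeff W p y = 0 := by
  have h1 : y ≠ p := fun e => h (by rw [e])
  have h2 : y ≠ p.opposite := fun e => h (by rw [e]; rfl)
  simp [passageCoeff, h1, h2]

/-! ### The third move -/

/-- The coefficients of the six passages of a third move: top at `a`, top at `b`, middle at `a`,
middle at `c`, bottom at `b`, bottom at `c`. -/
def threeCoeff (σa σb σc τa τb τc ρa ρb ρc : R) : Matrix (Fin 6) (Fin 6) R :=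
  !![σa, 0, 0, 0, 0, 0;
     0, σb, 0, 0, 0, 0;
     ρa, 0, τa, 0, 0, 0;
     0, 0, 0, σc, 0, 0;
     0, ρb, 0, 0, τb, 0;
     0, 0, 0, ρc, 0, τc]

/-- The order in which the six passages are met on the three strands. -/
def threeOrder (α β γ : ℤˣ) : Fin 6 → Fin 6 :=
  ![if α = 1 then 0 else 1, if α = 1 then 1 else 0, if β = 1 then 2 else 3,
    if β = 1 then 3 else 2, if γ = 1 then 4 else 5, if γ = 1 then 5 else 4]

theorem threeOrder_injective (α β γ : ℤˣ) : Function.Injective (threeOrder α β γ) := by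
  revert α β γ
  decide

theorem threeOrder_flipPairs (α β γ : ℤˣ) (i : Fin 6) :
    threeOrder α β γ (flipPairs i) = threeOrder (-α) (-β) (-γ) i := by
  revert α β γ i
  decide

/-- A strand receives contributions only from strands above it. With the pairs taken in the order
top, middle, bottom, no inner arc is fed back into its own relation, so all pivots are `-1`. -/
theorem isTriangular_threeCoeff (σa σb σc τa τb τc ρa ρb ρc : R) (α β γ : ℤˣ) :
    IsTriangular fun i j => threeCoeff σa σb σc τa τb τc ρa ρb ρc
      (threeOrder α β γ i) (threeOrder α β γ j) := by
  rcases Int.units_eq_one_or α with rfl | rfl <;> rcases Int.units_eq_one_or β with rfl | rfl <;>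
    rcases Int.units_eq_one_or γ with rfl | rfl <;>
    simp [IsTriangular, mergeCoeff, threeCoeff, threeOrder]

set_option maxHeartbeats 2000000 in
-- Ordered by height, both maps from incoming to outgoing strands are triangular, with equal
-- diagonals. For positive crossings and `α = 1` the entries top to middle, middle to bottom and top
-- to bottom give precisely `top`, `bot` and `mid`; for the other signs the identities follow from
-- these with the inverses of `s` and `t`.
theorem mergeThree_threeCoeff {a b c : LinearCrossing R} (h : a.Compatible b c)
    {ea eb ec α β γ : ℤˣ} (hβ : β = α * eb * ec) (hγ : γ = α * ea * ec) :
    ∀ i ∈ ({1, 3, 5} : Finset (Fin 6)), ∀ j ∈ ({1, 3, 5} : Finset (Fin 6)),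
      mergeThree (fun i j => threeCoeff (a.diag true ea : R) (b.diag true eb) (c.diag true ec)
        (a.diag false ea) (b.diag false eb) (c.diag false ec)
        (a.mix false ea) (b.mix false eb) (c.mix false ec)
        (threeOrder α β γ i) (threeOrder α β γ j)) i j =
      mergeThree (fun i j => threeCoeff (a.diag true ea : R) (b.diag true eb) (c.diag true ec)
        (a.diag false ea) (b.diag false eb) (c.diag false ec)
        (a.mix false ea) (b.mix false eb) (c.mix false ec)
        (threeOrder (-α) (-β) (-γ) i) (threeOrder (-α) (-β) (-γ) j)) i j := by
  obtain ⟨h1, h2, h3⟩ := h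
  obtain ⟨sa, ta, ra⟩ := a
  obtain ⟨sb, tb, rb⟩ := b
  obtain ⟨sc, tc, rc⟩ := c
  have i1 := sa.mul_inv
  have i2 := sb.mul_inv
  have i3 := sc.mul_inv
  have i4 := ta.mul_inv
  have i5 := tb.mul_inv
  have i6 := tc.mul_inv
  simp only at h1 h2 h3
  -- The signs of the three crossings and `α` determine `β` and `γ`, which leaves sixteen cases of
  -- six entries each. Units and inverses become free variables, tied only by `i1` to `i6`.
  rcases Int.units_eq_one_or α with rfl | rfl <;> rcases Int.units_eq_one_or ea with rfl | rfl <;>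
    rcases Int.units_eq_one_or eb with rfl | rfl <;>
    rcases Int.units_eq_one_or ec with rfl | rfl <;>
    simp [mergeThree, mergeCoeff, threeCoeff, threeOrder, LinearCrossing.diag,
      LinearCrossing.mix, hβ, hγ] <;>
    clear hβ hγ <;>
    generalize ((sa⁻¹ : Rˣ) : R) = sa' at * <;> generalize ((sb⁻¹ : Rˣ) : R) = sb' at * <;>
    generalize ((sc⁻¹ : Rˣ) : R) = sc' at * <;> generalize ((ta⁻¹ : Rˣ) : R) = ta' at * <;>
    generalize ((tb⁻¹ : Rˣ) : R) = tb' at * <;> generalize ((tc⁻¹ : Rˣ) : R) = tc' at * <;>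
    generalize (sa : R) = sa at * <;> generalize (sb : R) = sb at * <;>
    generalize (sc : R) = sc at * <;> generalize (ta : R) = ta at * <;>
    generalize (tb : R) = tb at * <;> generalize (tc : R) = tc at * <;>
    refine ⟨?_, ⟨?_, ?_⟩, ?_, ?_, ?_⟩ <;> first | ring1 | grind

end LinearCrossing

/-! ### The third move on lists of passages -/

section ReidemeisterDeterminants

variable {R : Type*} [CommRing R]

/-- The six passages of a third move. -/
def threePassages (a b c : ℕ) (ea eb ec : ℤˣ) : Fin 6 → Passage :=
  ![⟨true, a, ea⟩, ⟨true, b, eb⟩, ⟨false, a, ea⟩, ⟨true, c, ec⟩, ⟨false, b, eb⟩, ⟨false, c, ec⟩]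

theorem threePassages_injective {a b c : ℕ} (hab : a ≠ b) (hac : a ≠ c) (hbc : b ≠ c)
    (ea eb ec : ℤˣ) : Function.Injective (threePassages a b c ea eb ec) := by
  intro i j h
  fin_cases i <;> fin_cases j <;>
    simp_all [threePassages, Passage.mk.injEq, hab.symm, hac.symm, hbc.symm]

theorem passageCoeff_threePassages {a b c : ℕ} (hab : a ≠ b) (hac : a ≠ c) (hbc : b ≠ c)
    (ea eb ec : ℤˣ) (W : ℕ → LinearCrossing R) (i j : Fin 6) :
    passageCoeff W (threePassages a b c ea eb ec i) (threePassages a b c ea eb ec j) =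
      threeCoeff ((W a).diag true ea : R) ((W b).diag true eb) ((W c).diag true ec)
        ((W a).diag false ea) ((W b).diag false eb) ((W c).diag false ec)
        ((W a).mix false ea) ((W b).mix false eb) ((W c).mix false ec) i j := by
  fin_cases i <;> fin_cases j <;>
    simp [threePassages, passageCoeff, threeCoeff, Passage.opposite, LinearCrossing.mix,
      hab, hac, hbc, hab.symm, hac.symm, hbc.symm]

theorem orderedPair_eq (α : ℤˣ) (x y : Passage) :
    orderedPair α x y = [if α = 1 then x else y, if α = 1 then y else x] := by
  unfold orderedPair
  split_ifs <;> rfl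

/-- Passages interact only within a crossing, so a family that contains both passages of each of its
crossings is isolated from the rest. -/
theorem isBlock_passageCoeff {κ : Type*} {φ : κ → Passage}
    (h : ∀ i, (φ i).opposite ∈ Set.range φ) (W : ℕ → LinearCrossing R) :
    IsBlock φ (passageCoeff W) := by
  intro x hx i
  have h1 : φ i ≠ x := fun e => hx ⟨i, e⟩
  have h2 : φ i ≠ x.opposite := by
    intro e
    have h3 := h i
    rw [e] at h3
    exact hx (by simpa [Passage.opposite] using h3)
  have h3 : x ≠ (φ i).opposite := fun e => hx (e ▸ h i)
  simp [passageCoeff, h1, h2, h1.symm, h3]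

theorem map_flipPerm_of_forall {φ : Fin 6 → Passage} {u : List Passage}
    (h : ∀ p ∈ u, p ∉ Set.range φ) : u.map (flipPerm φ) = u := by
  conv_rhs => rw [← List.map_id u]
  exact List.map_congr_left fun x hx => flipPerm_of_notMem (h x hx)

/-- The six passages of a third move in the order in which they are met. -/
def orderedPassages (a b c : ℕ) (ea eb ec α β γ : ℤˣ) (i : Fin 6) : Passage :=
  threePassages a b c ea eb ec (threeOrder α β γ i)

section

variable {a b c : ℕ} {ea eb ec α β γ : ℤˣ}

theorem orderedPair_top :
    orderedPair α ⟨true, a, ea⟩ ⟨true, b, eb⟩ =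
      [orderedPassages a b c ea eb ec α β γ 0, orderedPassages a b c ea eb ec α β γ 1] ∧
    orderedPair (-α) ⟨true, a, ea⟩ ⟨true, b, eb⟩ =
      [orderedPassages a b c ea eb ec α β γ 1, orderedPassages a b c ea eb ec α β γ 0] := by
  rcases Int.units_eq_one_or α with rfl | rfl <;>
    simp [orderedPair, orderedPassages, threePassages, threeOrder]

theorem orderedPair_mid :
    orderedPair β ⟨false, a, ea⟩ ⟨true, c, ec⟩ =
      [orderedPassages a b c ea eb ec α β γ 2, orderedPassages a b c ea eb ec α β γ 3] ∧
    orderedPair (-β) ⟨false, a, ea⟩ ⟨true, c, ec⟩ =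
      [orderedPassages a b c ea eb ec α β γ 3, orderedPassages a b c ea eb ec α β γ 2] := by
  rcases Int.units_eq_one_or β with rfl | rfl <;>
    simp [orderedPair, orderedPassages, threePassages, threeOrder]

theorem orderedPair_bot :
    orderedPair γ ⟨false, b, eb⟩ ⟨false, c, ec⟩ =
      [orderedPassages a b c ea eb ec α β γ 4, orderedPassages a b c ea eb ec α β γ 5] ∧
    orderedPair (-γ) ⟨false, b, eb⟩ ⟨false, c, ec⟩ =
      [orderedPassages a b c ea eb ec α β γ 5, orderedPassages a b c ea eb ec α β γ 4] := by
  rcases Int.units_eq_one_or γ with rfl | rfl <;>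
    simp [orderedPair, orderedPassages, threePassages, threeOrder]

theorem orderedPassages_injective (hab : a ≠ b) (hac : a ≠ c) (hbc : b ≠ c) :
    Function.Injective (orderedPassages a b c ea eb ec α β γ) :=
  (threePassages_injective hab hac hbc ea eb ec).comp (threeOrder_injective α β γ)

theorem orderedPassages_opposite_mem (i : Fin 6) :
    (orderedPassages a b c ea eb ec α β γ i).opposite ∈
      Set.range (orderedPassages a b c ea eb ec α β γ) := by
  have hs : Function.Surjective (threeOrder α β γ) :=
    Finite.injective_iff_surjective.1 (threeOrder_injective α β γ)
  have h : ∀ j, ∃ k, (threePassages a b c ea eb ec j).opposite =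
      threePassages a b c ea eb ec k := by
    intro j
    fin_cases j
    exacts [⟨2, rfl⟩, ⟨4, rfl⟩, ⟨0, rfl⟩, ⟨5, rfl⟩, ⟨1, rfl⟩, ⟨3, rfl⟩]
  obtain ⟨k, hk⟩ := h (threeOrder α β γ i)
  obtain ⟨m, rfl⟩ := hs k
  exact ⟨m, hk.symm⟩

/-- The determinant does not change if the two passages in each of the three pairs of a third move
are exchanged. -/
theorem cyclicDet_map_orderedPassages (hab : a ≠ b) (hac : a ≠ c) (hbc : b ≠ c)
    (hβ : β = α * eb * ec) (hγ : γ = α * ea * ec)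
    {W : ℕ → LinearCrossing R} (h : (W a).Compatible (W b) (W c))
    {l u₀ v₀ u₁ v₁ u₂ v₂ : List Passage} (hn : l.Nodup)
    {φ : Fin 6 → Passage} (hφ : φ = orderedPassages a b c ea eb ec α β γ)
    (h₀ : l = u₀ ++ [φ 0, φ 1] ++ v₀)
    (h₁ : u₀ ++ [φ 1] ++ v₀ = u₁ ++ [φ 2, φ 3] ++ v₁)
    (h₂ : u₁ ++ [φ 3] ++ v₁ = u₂ ++ [φ 4, φ 5] ++ v₂) :
    cyclicDet (l.map (flipPerm φ)) (passageCoeff W) = cyclicDet l (passageCoeff W) := by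
  subst hφ
  have hc : ∀ i j : Fin 6, passageCoeff W (orderedPassages a b c ea eb ec α β γ i)
      (orderedPassages a b c ea eb ec α β γ j) = _ := fun i j =>
    passageCoeff_threePassages hab hac hbc ea eb ec W (threeOrder α β γ i) (threeOrder α β γ j)
  refine cyclicDet_map_flipPerm (orderedPassages_injective hab hac hbc)
    (isBlock_passageCoeff orderedPassages_opposite_mem W) hn h₀ h₁ h₂ ?_ ?_ ?_
  · simp only [hc]
    exact isTriangular_threeCoeff _ _ _ _ _ _ _ _ _ α β γ
  · simp only [hc, threeOrder_flipPairs]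
    exact isTriangular_threeCoeff _ _ _ _ _ _ _ _ _ (-α) (-β) (-γ)
  · simp only [hc, threeOrder_flipPairs]
    exact mergeThree_threeCoeff h hβ hγ

theorem notMem_range_of_perm {φ : Fin 6 → Passage} {l u : List Passage} (hn : l.Nodup)
    (h : l.Perm ([φ 0, φ 1, φ 2, φ 3, φ 4, φ 5] ++ u)) : ∀ p ∈ u, p ∉ Set.range φ := by
  rintro p hp ⟨i, rfl⟩
  refine (List.nodup_append.1 (h.nodup_iff.1 hn)).2.2 (φ i) ?_ (φ i) hp rfl
  fin_cases i <;> simp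

theorem cyclicDet_three_top_mid_bot (hab : a ≠ b) (hac : a ≠ c) (hbc : b ≠ c)
    (hβ : β = α * eb * ec) (hγ : γ = α * ea * ec)
    {W : ℕ → LinearCrossing R} (h : (W a).Compatible (W b) (W c)) {u v w : List Passage}
    (hn : (orderedPair α ⟨true, a, ea⟩ ⟨true, b, eb⟩ ++ u ++
          orderedPair β ⟨false, a, ea⟩ ⟨true, c, ec⟩ ++ v ++
          orderedPair γ ⟨false, b, eb⟩ ⟨false, c, ec⟩ ++ w).Nodup) :
    cyclicDet (orderedPair (-α) ⟨true, a, ea⟩ ⟨true, b, eb⟩ ++ u ++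
          orderedPair (-β) ⟨false, a, ea⟩ ⟨true, c, ec⟩ ++ v ++
          orderedPair (-γ) ⟨false, b, eb⟩ ⟨false, c, ec⟩ ++ w) (passageCoeff W) =
    cyclicDet (orderedPair α ⟨true, a, ea⟩ ⟨true, b, eb⟩ ++ u ++
          orderedPair β ⟨false, a, ea⟩ ⟨true, c, ec⟩ ++ v ++
          orderedPair γ ⟨false, b, eb⟩ ⟨false, c, ec⟩ ++ w) (passageCoeff W) := by
  obtain ⟨t1, t2⟩ := orderedPair_top (a := a) (b := b) (c := c) (ea := ea) (eb := eb) (ec := ec)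
    (α := α) (β := β) (γ := γ)
  obtain ⟨m1, m2⟩ := orderedPair_mid (a := a) (b := b) (c := c) (ea := ea) (eb := eb) (ec := ec)
    (α := α) (β := β) (γ := γ)
  obtain ⟨b1, b2⟩ := orderedPair_bot (a := a) (b := b) (c := c) (ea := ea) (eb := eb) (ec := ec)
    (α := α) (β := β) (γ := γ)
  rw [t1, m1, b1] at hn
  rw [t1, t2, m1, m2, b1, b2]
  have hap := flipPerm_apply (orderedPassages_injective (ea := ea) (eb := eb) (ec := ec) (α := α)
    (β := β) (γ := γ) hab hac hbc)
  generalize hφ : orderedPassages a b c ea eb ec α β γ = φ at *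
  rw [← cyclicDet_map_orderedPassages hab hac hbc hβ hγ h hn hφ.symm
    (u₀ := []) (v₀ := u ++ [φ 2, φ 3] ++ v ++ [φ 4, φ 5] ++ w) (u₁ := φ 1 :: u)
    (v₁ := v ++ [φ 4, φ 5] ++ w) (u₂ := φ 1 :: (u ++ φ 3 :: v)) (v₂ := w)
    (by simp) (by simp) (by simp)]
  have hout : ∀ p ∈ u ++ v ++ w, p ∉ Set.range φ := by
    refine notMem_range_of_perm hn (List.perm_iff_count.2 fun x => ?_)
    simp only [List.count_append, List.count_cons, List.count_nil]
    ring
  congr 1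
  simp only [List.map_append, List.map_cons, List.map_nil, hap]
  rw [map_flipPerm_of_forall fun p hp => hout p (by simp [hp]),
    map_flipPerm_of_forall fun p hp => hout p (by simp [hp]),
    map_flipPerm_of_forall fun p hp => hout p (by simp [hp])]
  rfl

theorem cyclicDet_three_top_bot_mid (hab : a ≠ b) (hac : a ≠ c) (hbc : b ≠ c)
    (hβ : β = α * eb * ec) (hγ : γ = α * ea * ec)
    {W : ℕ → LinearCrossing R} (h : (W a).Compatible (W b) (W c)) {u v w : List Passage}
    (hn : (orderedPair α ⟨true, a, ea⟩ ⟨true, b, eb⟩ ++ u ++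
          orderedPair γ ⟨false, b, eb⟩ ⟨false, c, ec⟩ ++ v ++
          orderedPair β ⟨false, a, ea⟩ ⟨true, c, ec⟩ ++ w).Nodup) :
    cyclicDet (orderedPair (-α) ⟨true, a, ea⟩ ⟨true, b, eb⟩ ++ u ++
          orderedPair (-γ) ⟨false, b, eb⟩ ⟨false, c, ec⟩ ++ v ++
          orderedPair (-β) ⟨false, a, ea⟩ ⟨true, c, ec⟩ ++ w) (passageCoeff W) =
    cyclicDet (orderedPair α ⟨true, a, ea⟩ ⟨true, b, eb⟩ ++ u ++
          orderedPair γ ⟨false, b, eb⟩ ⟨false, c, ec⟩ ++ v ++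
          orderedPair β ⟨false, a, ea⟩ ⟨true, c, ec⟩ ++ w) (passageCoeff W) := by
  obtain ⟨t1, t2⟩ := orderedPair_top (a := a) (b := b) (c := c) (ea := ea) (eb := eb) (ec := ec)
    (α := α) (β := β) (γ := γ)
  obtain ⟨m1, m2⟩ := orderedPair_mid (a := a) (b := b) (c := c) (ea := ea) (eb := eb) (ec := ec)
    (α := α) (β := β) (γ := γ)
  obtain ⟨b1, b2⟩ := orderedPair_bot (a := a) (b := b) (c := c) (ea := ea) (eb := eb) (ec := ec)
    (α := α) (β := β) (γ := γ)
  rw [t1, m1, b1] at hn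
  rw [t1, t2, m1, m2, b1, b2]
  have hap := flipPerm_apply (orderedPassages_injective (ea := ea) (eb := eb) (ec := ec) (α := α)
    (β := β) (γ := γ) hab hac hbc)
  generalize hφ : orderedPassages a b c ea eb ec α β γ = φ at *
  -- Here the bottom pair precedes the middle pair in the code, but the elimination still goes by
  -- height: top, middle, bottom.
  rw [← cyclicDet_map_orderedPassages hab hac hbc hβ hγ h hn hφ.symm
    (u₀ := []) (v₀ := u ++ [φ 4, φ 5] ++ v ++ [φ 2, φ 3] ++ w)
    (u₁ := φ 1 :: (u ++ φ 4 :: φ 5 :: v)) (v₁ := w) (u₂ := φ 1 :: u) (v₂ := v ++ φ 3 :: w)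
    (by simp) (by simp) (by simp)]
  have hout : ∀ p ∈ u ++ v ++ w, p ∉ Set.range φ := by
    refine notMem_range_of_perm hn (List.perm_iff_count.2 fun x => ?_)
    simp only [List.count_append, List.count_cons, List.count_nil]
    ring
  congr 1
  simp only [List.map_append, List.map_cons, List.map_nil, hap]
  rw [map_flipPerm_of_forall fun p hp => hout p (by simp [hp]),
    map_flipPerm_of_forall fun p hp => hout p (by simp [hp]),
    map_flipPerm_of_forall fun p hp => hout p (by simp [hp])]
  rfl

end

end ReidemeisterDeterminants

/-! ### The first and the second move on lists of passages -/

section ReidemeisterDeterminants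

variable {R : Type*} [CommRing R]

theorem orderedPair_one (x y : Passage) : orderedPair 1 x y = [x, y] := by
  simp [orderedPair]

theorem orderedPair_neg_one (x y : Passage) : orderedPair (-1) x y = [y, x] := by
  simp [orderedPair]

theorem cyclicDet_one (o : Bool) (a : ℕ) (e : ℤˣ) (u : List Passage)
    (hn : (⟨o, a, e⟩ :: ⟨!o, a, e⟩ :: u : List Passage).Nodup) (ha : ∀ p ∈ u, p.label ≠ a)
    (W : ℕ → LinearCrossing R) (hW : (W a).r = 1 - (W a).s * (W a).t) :
    ∃ k : ℤ, cyclicDet (⟨o, a, e⟩ :: ⟨!o, a, e⟩ :: u : List Passage) (passageCoeff W) =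
      (((W a).s * (W a).t) ^ k : Rˣ) * cyclicDet u (passageCoeff W) := by
  -- If the curl is first run through above, nothing is mixed in and the pivot is `-1`. Otherwise `r
  -- = 1 - s t` gives `d = s t` or its inverse, so `k` is the sign of the crossing. In all cases the
  -- merged passage then simply passes its arc on.
  obtain ⟨k, hk⟩ : ∃ k : ℤ,
      passageCoeff W ⟨o, a, e⟩ ⟨!o, a, e⟩ = 1 - (((W a).s * (W a).t) ^ k : Rˣ) ∧
      passageCoeff W ⟨!o, a, e⟩ ⟨o, a, e⟩ + passageCoeff W ⟨!o, a, e⟩ ⟨!o, a, e⟩ *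
        ((((W a).s * (W a).t) ^ k : Rˣ)⁻¹ : Rˣ) * passageCoeff W ⟨o, a, e⟩ ⟨o, a, e⟩ = 1 := by
    have i1 := (W a).s.mul_inv
    have i2 := (W a).t.mul_inv
    cases o <;> rcases Int.units_eq_one_or e with rfl | rfl
    · refine ⟨1, ?_⟩
      simp [passageCoeff, Passage.opposite, LinearCrossing.mix, LinearCrossing.diag, hW]
      grind
    · refine ⟨-1, ?_⟩
      simp [passageCoeff, Passage.opposite, LinearCrossing.mix, LinearCrossing.diag, hW]
      grind
    · refine ⟨0, ?_⟩
      simp [passageCoeff, Passage.opposite, LinearCrossing.mix, LinearCrossing.diag, hW]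
      grind
    · refine ⟨0, ?_⟩
      simp [passageCoeff, Passage.opposite, LinearCrossing.mix, LinearCrossing.diag, hW]
      grind
  refine ⟨k, ?_⟩
  generalize ((W a).s * (W a).t) ^ k = d at hk ⊢
  have hK : ∀ p q : Passage, p.label ≠ q.label → passageCoeff W p q = 0 := fun p q h =>
    passageCoeff_of_label_ne W h.symm
  have hqu : (⟨!o, a, e⟩ : Passage) ∉ u := (List.nodup_cons.1 (List.nodup_cons.1 hn).2).1
  rw [cyclicDet_cons_cons hn d _ hk.1, cyclicDet_cons_of_pass (List.nodup_cons.1 hn).2]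
  · rw [neg_mul_neg]
    congr 1
    refine cyclicDet_congr fun x hx y hy => ?_
    have hy' : y ≠ ⟨!o, a, e⟩ := fun h => hqu (h ▸ hy)
    simp [mergeCoeff, hy', hK x ⟨!o, a, e⟩ (ha x hx)]
  · intro y hy
    rcases List.mem_cons.1 hy with rfl | hy
    · simpa [mergeCoeff] using hk.2
    · have hy' : y ≠ ⟨!o, a, e⟩ := fun h => hqu (h ▸ hy)
      simp [mergeCoeff, hy', hK ⟨_, a, e⟩ y (ha y hy).symm]
  · intro x hx
    simp [mergeCoeff, hK x ⟨_, a, e⟩ (ha x hx)]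

/-- Two pairs of items that interact only with one another and pass on the arcs leading into them
can be removed. -/
theorem cyclicDet_of_pass_pairs {ι : Type*} [DecidableEq ι] {A B p q : ι} {u v : List ι}
    (hn : ([A, B] ++ u ++ [p, q] ++ v).Nodup) (K K' : ι → ι → R)
    (hx : ∀ x ∈ u ++ v, ∀ r ∈ [A, B, p, q], K x r = 0 ∧ K r x = 0)
    (hK' : K' = mergeCoeff p q 1 (mergeCoeff A B 1 K))
    (hAB : K A B = 0) (hpq : mergeCoeff A B 1 K p q = 0)
    (hqq : K' q q = 1) (hqB : K' q B = 0) (hBq : K' B q = 0) (hBB : K' B B = 1) :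
    cyclicDet ([A, B] ++ u ++ [p, q] ++ v) K = cyclicDet (u ++ v) K := by
  have hn1 : ([B] ++ u ++ [p, q] ++ v).Nodup := hn.sublist (by simp)
  have hn2 : ([B] ++ u ++ [q] ++ v).Nodup := hn1.sublist (by simp)
  have hn3 : (u ++ [q] ++ v).Nodup := hn2.sublist (by simp)
  have e1 : cyclicDet ([A, B] ++ u ++ [p, q] ++ v) K =
      -cyclicDet ([B] ++ u ++ [p, q] ++ v) (mergeCoeff A B 1 K) := by
    have := cyclicDet_merge (u := []) (v := u ++ [p, q] ++ v) (by simpa using hn) 1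
      K (by simpa using hAB)
    simpa using this
  have e2 : [B] ++ u ++ [q] ++ v = B :: (u ++ [q] ++ v) := by simp
  have hmem : ∀ y ∈ u ++ [q] ++ v, y = q ∨ y ∈ u ++ v := by
    intro y hy
    simp only [List.mem_append, List.mem_singleton] at hy ⊢
    tauto
  have hBn : B ∉ u ++ [q] ++ v := by
    rw [e2] at hn2
    exact (List.nodup_cons.1 hn2).1
  have hqn : q ∉ u ++ v := by
    have : (q :: (u ++ v)).Nodup := (List.perm_middle (a := q) (l₁ := u) (l₂ := v)).nodup_iff.1
      (by simpa using hn3)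
    exact (List.nodup_cons.1 this).1
  have hx' : ∀ x ∈ u ++ v, (K' x q = 0 ∧ K' q x = 0) ∧ (K' x B = 0 ∧ K' B x = 0) ∧
      ∀ y ∈ u ++ v, K' x y = K x y := by
    intro x hxm
    have hxq : x ≠ q := fun h => hqn (h ▸ hxm)
    have hxB : x ≠ B := by
      rintro rfl
      refine hBn ?_
      simp only [List.mem_append] at hxm ⊢
      tauto
    have hA := hx x hxm A (by simp)
    have hB := hx x hxm B (by simp)
    have hp := hx x hxm p (by simp)
    have hq := hx x hxm q (by simp)
    subst hK'
    refine ⟨?_, ?_, fun y hy => ?_⟩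
    · simp only [mergeCoeff, hxB, hxq, if_false]
      constructor <;> split_ifs <;> simp [hA, hB, hp, hq]
    · simp only [mergeCoeff, hxB, hxq, if_false]
      constructor <;> split_ifs <;> simp [hA, hB, hp, hq]
    · have hyq : y ≠ q := fun h => hqn (h ▸ hy)
      have hyB : y ≠ B := by
        rintro rfl
        refine hBn ?_
        simp only [List.mem_append] at hy ⊢
        tauto
      simp only [mergeCoeff, hyB, hyq, if_false]
      split_ifs <;> simp [hB, hq, hA]
  rw [e1, cyclicDet_merge hn1 1 _ (by simpa using hpq)]
  simp only [Units.val_one, inv_one, neg_mul, one_mul, neg_neg, ← hK']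
  rw [e2, cyclicDet_cons_of_pass (e2 ▸ hn2), cyclicDet_of_pass hn3, neg_neg]
  · exact cyclicDet_congr fun x hxm y hy => (hx' x hxm).2.2 y hy
  · intro y hy
    rcases hmem y hy with rfl | hy
    · simpa using hqq
    · rw [if_neg fun h : y = q => hqn (h ▸ hy)]
      exact (hx' y hy).1.2
  · intro x hxm
    exact (hx' x hxm).1.1
  · intro y hy
    rcases List.mem_cons.1 hy with rfl | hy
    · simpa using hBB
    · rw [if_neg fun h : y = B => hBn (h ▸ hy)]
      rcases hmem y hy with rfl | hy
      · exact hBq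
      · exact (hx' y hy).2.1.2
  · intro x hxm
    rcases hmem x hxm with rfl | hxm
    · exact hqB
    · exact (hx' x hxm).2.1.1

set_option maxHeartbeats 400000 in
-- Equal maps with opposite signs: along each strand the coefficients multiply to 1, and the two
-- contributions of the over strand to the under strand cancel, whichever crossing the under strand
-- meets first.
theorem cyclicDet_two (o : ℤˣ) {a b : ℕ} (hab : a ≠ b) (e : ℤˣ) (u v : List Passage)
    (hn : (([⟨true, a, e⟩, ⟨true, b, -e⟩] : List Passage) ++ u ++
      orderedPair o ⟨false, a, e⟩ ⟨false, b, -e⟩ ++ v).Nodup)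
    (ha : ∀ p ∈ u ++ v, p.label ≠ a ∧ p.label ≠ b)
    (W : ℕ → LinearCrossing R) (hW : W a = W b) :
    cyclicDet (([⟨true, a, e⟩, ⟨true, b, -e⟩] : List Passage) ++ u ++
      orderedPair o ⟨false, a, e⟩ ⟨false, b, -e⟩ ++ v) (passageCoeff W) =
      cyclicDet (u ++ v) (passageCoeff W) := by
  have hB : ∀ x ∈ u ++ v, ∀ r : Passage, r.label = a ∨ r.label = b →
      passageCoeff W x r = 0 ∧ passageCoeff W r x = 0 := by
    intro x hx r hr
    obtain ⟨hxa, hxb⟩ := ha x hx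
    have hne : r.label ≠ x.label := by
      rcases hr with hr | hr <;> rw [hr]
      exacts [hxa.symm, hxb.symm]
    exact ⟨passageCoeff_of_label_ne W hne, passageCoeff_of_label_ne W hne.symm⟩
  have i1 := (W b).s.mul_inv
  have i2 := (W b).t.mul_inv
  rcases Int.units_eq_one_or o with rfl | rfl
  · rw [orderedPair_one] at hn ⊢
    apply cyclicDet_of_pass_pairs hn (passageCoeff W) (mergeCoeff ⟨false, a, e⟩ ⟨false, b, -e⟩ 1
      (mergeCoeff ⟨true, a, e⟩ ⟨true, b, -e⟩ 1 (passageCoeff W)))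
    · intro x hx r hr
      refine hB x hx r ?_
      simp only [List.mem_cons, List.not_mem_nil, or_false] at hr
      rcases hr with rfl | rfl | rfl | rfl <;> simp
    · rfl
    all_goals
      clear hn ha hB
      rcases Int.units_eq_one_or e with rfl | rfl <;>
      simp [mergeCoeff, passageCoeff, Passage.opposite, LinearCrossing.mix, LinearCrossing.diag,
        hW, hab, hab.symm] <;> grind
  · rw [orderedPair_neg_one] at hn ⊢
    apply cyclicDet_of_pass_pairs hn (passageCoeff W) (mergeCoeff ⟨false, b, -e⟩ ⟨false, a, e⟩ 1
      (mergeCoeff ⟨true, a, e⟩ ⟨true, b, -e⟩ 1 (passageCoeff W)))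
    · intro x hx r hr
      refine hB x hx r ?_
      simp only [List.mem_cons, List.not_mem_nil, or_false] at hr
      rcases hr with rfl | rfl | rfl | rfl <;> simp
    · rfl
    all_goals
      clear hn ha hB
      rcases Int.units_eq_one_or e with rfl | rfl <;>
      simp [mergeCoeff, passageCoeff, Passage.opposite, LinearCrossing.mix, LinearCrossing.diag,
        hW, hab, hab.symm] <;> grind

end ReidemeisterDeterminants

/-! ### Parity of crossings under the moves -/

theorem Passage.opposite_opposite (p : Passage) : p.opposite.opposite = p := by
  simp [Passage.opposite]

theorem Passage.opposite_ne (p : Passage) : p.opposite ≠ p := by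
  cases p
  simp [Passage.opposite]

section IdxOf

variable {ι : Type*} [DecidableEq ι]

theorem List.idxOf_insert_pair {p a b : ι} (ha : p ≠ a) (hb : p ≠ b) (x y : List ι) :
    (x ++ [a, b] ++ y).idxOf p % 2 = (x ++ y).idxOf p % 2 := by
  by_cases hx : p ∈ x
  · rw [List.append_assoc, List.idxOf_append_of_mem hx, List.idxOf_append_of_mem hx]
  · rw [List.append_assoc, List.idxOf_append_of_notMem hx, List.idxOf_append_of_notMem hx,
      List.idxOf_append_of_notMem (by simp [ha, hb])]
    simp only [List.length_cons, List.length_nil]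
    omega

/-- Items of `x` move forward by the length of `y`, items of `y` back by the length of `x`. These
shifts agree modulo 2 because the total length is even. -/
theorem List.idxOf_append_comm {p : ι} {x y : List ι} (hn : (x ++ y).Nodup)
    (he : Even (x ++ y).length) (hp : p ∈ x ++ y) :
    (y ++ x).idxOf p % 2 = ((x ++ y).idxOf p + x.length) % 2 := by
  rw [List.length_append] at he
  rw [Nat.even_iff] at he
  have hd := (List.nodup_append.1 hn).2.2
  rcases List.mem_append.1 hp with h | h
  · have hy : p ∉ y := fun hy => hd p h p hy rfl
    rw [List.idxOf_append_of_mem h, List.idxOf_append_of_notMem hy]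
    omega
  · have hx : p ∉ x := fun hx => hd p hx p h rfl
    rw [List.idxOf_append_of_mem h, List.idxOf_append_of_notMem hx]
    omega

end IdxOf

theorem mem_orderedPair {α : ℤˣ} {p x y : Passage} : p ∈ orderedPair α x y ↔ p = x ∨ p = y := by
  unfold orderedPair
  split_ifs <;> simp [or_comm]

theorem nodup_orderedPair {α : ℤˣ} {x y : Passage} : (orderedPair α x y).Nodup ↔ x ≠ y := by
  unfold orderedPair
  split_ifs <;> simp [eq_comm]

theorem length_orderedPair (α : ℤˣ) (x y : Passage) : (orderedPair α x y).length = 2 := by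
  unfold orderedPair
  split_ifs <;> simp

theorem orderedPair_perm (α : ℤˣ) (x y : Passage) : (orderedPair α x y).Perm [x, y] := by
  unfold orderedPair
  split_ifs
  · exact .refl _
  · exact .swap _ _ _

theorem idxOf_orderedPair_neg {α : ℤˣ} {a b p : Passage} {x y : List Passage}
    (hn : (x ++ (orderedPair α a b ++ y)).Nodup) :
    (x ++ (orderedPair (-α) a b ++ y)).idxOf p % 2 =
      ((x ++ (orderedPair α a b ++ y)).idxOf p + if p = a ∨ p = b then 1 else 0) % 2 := by
  have hd := (List.nodup_append.1 hn).2.2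
  have hab : a ≠ b :=
    nodup_orderedPair.1 (List.nodup_append.1 (List.nodup_append.1 hn).2.1).1
  have hax : a ∉ x := fun h => hd a h a (by simp [mem_orderedPair]) rfl
  have hbx : b ∉ x := fun h => hd b h b (by simp [mem_orderedPair]) rfl
  by_cases hx : p ∈ x
  · have h1 : p ≠ a := fun h => hax (h ▸ hx)
    have h2 : p ≠ b := fun h => hbx (h ▸ hx)
    rw [List.idxOf_append_of_mem hx, List.idxOf_append_of_mem hx]
    simp [h1, h2]
  · rw [List.idxOf_append_of_notMem hx, List.idxOf_append_of_notMem hx]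
    by_cases hp : p = a ∨ p = b
    · rw [List.idxOf_append_of_mem (mem_orderedPair.2 hp),
        List.idxOf_append_of_mem (mem_orderedPair.2 hp), if_pos hp]
      rcases Int.units_eq_one_or α with rfl | rfl <;> rcases hp with rfl | rfl <;>
        simp [orderedPair, List.idxOf_cons_ne, hab, hab.symm] <;> omega
    · rw [List.idxOf_append_of_notMem (by simpa [mem_orderedPair] using hp),
        List.idxOf_append_of_notMem (by simpa [mem_orderedPair] using hp), if_neg hp]
      simp [length_orderedPair]

theorem idxOf_orderedPair_add {α : ℤˣ} {a b : Passage} {x y : List Passage}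
    (hn : (x ++ (orderedPair α a b ++ y)).Nodup) :
    ((x ++ (orderedPair α a b ++ y)).idxOf a + (x ++ (orderedPair α a b ++ y)).idxOf b) % 2 = 1 := by
  have hd := (List.nodup_append.1 hn).2.2
  have hab : a ≠ b :=
    nodup_orderedPair.1 (List.nodup_append.1 (List.nodup_append.1 hn).2.1).1
  have hax : a ∉ x := fun h => hd a h a (by simp [mem_orderedPair]) rfl
  have hbx : b ∉ x := fun h => hd b h b (by simp [mem_orderedPair]) rfl
  rw [List.idxOf_append_of_notMem hax, List.idxOf_append_of_notMem hbx,
    List.idxOf_append_of_mem (by simp [mem_orderedPair]),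
    List.idxOf_append_of_mem (by simp [mem_orderedPair])]
  rcases Int.units_eq_one_or α with rfl | rfl <;>
    simp [orderedPair, List.idxOf_cons_ne, hab, hab.symm] <;> omega

namespace GaussCode

theorem odd_termsBetween_iff (D : GaussCode) {p : Passage} (hp : p ∈ D.passages) :
    Odd (D.termsBetween p) ↔
      (D.passages.idxOf p + D.passages.idxOf p.opposite) % 2 = 0 := by
  have hne : D.passages.idxOf p ≠ D.passages.idxOf p.opposite := fun h =>
    p.opposite_ne ((List.idxOf_inj hp).1 h).symm
  rw [termsBetween, Nat.odd_iff]
  omega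

theorem termsBetween_opposite (D : GaussCode) (p : Passage) :
    D.termsBetween p.opposite = D.termsBetween p := by
  simp only [termsBetween, Passage.opposite_opposite]
  rw [max_comm, min_comm]

/-- The map `opposite` is an involution without fixed points; counting in `ZMod 2`, the two members
of each pair cancel. -/
theorem even_length (D : GaussCode) : Even D.passages.length := by
  have h : (∑ _p ∈ D.passages.toFinset, (1 : ZMod 2)) = 0 :=
    Finset.sum_involution (fun p _ => p.opposite) (fun p _ => by decide)
      (fun p _ _ => p.opposite_ne) (fun p hp => by simpa using D.opposite_mem p (by simpa using hp))
      (fun p _ => p.opposite_opposite)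
  rw [Finset.sum_const, List.toFinset_card_of_nodup D.nodup, nsmul_eq_mul, mul_one] at h
  exact (ZMod.natCast_eq_zero_iff_even).1 h

/-- The crossing with label `n` is odd. -/
def IsOddLabel (D : GaussCode) (n : ℕ) : Prop :=
  ∃ p ∈ D.passages, p.label = n ∧ Odd (D.termsBetween p)

theorem isOddLabel_label (D : GaussCode) {p : Passage} (hp : p ∈ D.passages) :
    D.IsOddLabel p.label ↔ Odd (D.termsBetween p) := by
  constructor
  · rintro ⟨q, hq, hl, ho⟩
    rcases D.eq_or_eq_opposite q hq p hp hl with rfl | rfl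
    · exact ho
    · rwa [termsBetween_opposite]
  · exact fun h => ⟨p, hp, rfl, h⟩

theorem isOddLabel_label_iff (D : GaussCode) {p : Passage} (hp : p ∈ D.passages) :
    D.IsOddLabel p.label ↔ (D.passages.idxOf p + D.passages.idxOf p.opposite) % 2 = 0 := by
  rw [isOddLabel_label D hp, odd_termsBetween_iff D hp]

/-- Two codes give the crossing of `p` the same parity if the positions of `p` and of `p.opposite`
change by numbers of the same parity. -/
theorem isOddLabel_iff_of_idxOf {D D' : GaussCode} {p : Passage} (hp : p ∈ D.passages)
    (hp' : p ∈ D'.passages) (k : ℕ)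
    (h : D'.passages.idxOf p % 2 = (D.passages.idxOf p + k) % 2)
    (h' : D'.passages.idxOf p.opposite % 2 = (D.passages.idxOf p.opposite + k) % 2) :
    D'.IsOddLabel p.label ↔ D.IsOddLabel p.label := by
  rw [isOddLabel_label_iff D hp, isOddLabel_label_iff D' hp']
  omega

/-- The moves do not require their labels to be distinct or new; this supplies it, from the fact
that both sides of a move are Gauss codes. -/
theorem label_ne_of_notMem (D : GaussCode) {p q : Passage} (hp : p ∈ D.passages)
    (hq : q ∈ D.passages) (h : p ≠ q) (h' : p ≠ q.opposite) : p.label ≠ q.label := fun e => by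
  rcases D.eq_or_eq_opposite q hq p hp e.symm with h1 | h1
  exacts [h h1, h' h1]

end GaussCode

theorem List.idxOf_map_injective {ι κ : Type*} [DecidableEq ι] [DecidableEq κ] {f : ι → κ}
    (hf : Function.Injective f) (l : List ι) (x : ι) : (l.map f).idxOf (f x) = l.idxOf x := by
  induction l with
  | nil => rfl
  | cons y t ih =>
    by_cases h : y = x
    · subst h
      simp
    · rw [List.map_cons, List.idxOf_cons_ne _ h, List.idxOf_cons_ne _ (hf.ne h), ih]

/-! ### The polynomial as a cyclic determinant; base point, renumbering and the first move -/

section Polynomial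

variable {R : Type*} [CommRing R]

/-- The map of a positive crossing. -/
def LinearCrossing.matrix (c : LinearCrossing R) : Matrix (Fin 2) (Fin 2) R := !![0, c.s; c.t, c.r]

theorem LinearCrossing.matrix_inv (c : LinearCrossing R) :
    c.matrix⁻¹ = !![-c.r * ↑c.s⁻¹ * ↑c.t⁻¹, ↑c.t⁻¹; ↑c.s⁻¹, 0] := by
  refine Matrix.inv_eq_right_inv ?_
  rw [LinearCrossing.matrix, Matrix.mul_fin_two, Matrix.one_fin_two]
  have i1 := c.s.mul_inv
  have i2 := c.t.mul_inv
  ext i j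
  fin_cases i <;> fin_cases j <;> (simp; try grind)

namespace GaussCode

open Classical in
/-- The crossings of a diagram with the map `P` at the odd and `B` at the even ones. -/
noncomputable def weight (D : GaussCode) (B P : LinearCrossing R) (n : ℕ) : LinearCrossing R :=
  if D.IsOddLabel n then P else B

theorem weight_eq {D D' : GaussCode} {n m : ℕ} (h : D.IsOddLabel n ↔ D'.IsOddLabel m)
    (B P : LinearCrossing R) : D.weight B P n = D'.weight B P m := by
  unfold weight
  split_ifs <;> tauto

theorem crossingMap_eq (D : GaussCode) (B P : LinearCrossing R) (p : D.Arc) :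
    D.crossingMap B.matrix P.matrix p =
      if p.1.sign = 1 then (D.weight B P p.1.label).matrix
      else (D.weight B P p.1.label).matrix⁻¹ := by
  have h : (if Odd (D.termsBetween p.1) then P.matrix else B.matrix) =
      (D.weight B P p.1.label).matrix := by
    simp only [weight, D.isOddLabel_label p.2]
    split_ifs <;> rfl
  simp only [crossingMap, h]

theorem crossingMap_diag (D : GaussCode) (B P : LinearCrossing R) (p : D.Arc) :
    D.crossingMap B.matrix P.matrix p (D.outputIndex p) (D.inputIndex p) =
      (D.weight B P p.1.label).diag p.1.isOver p.1.sign := by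
  rw [crossingMap_eq]
  generalize D.weight B P p.1.label = c
  rw [LinearCrossing.matrix_inv]
  obtain ⟨⟨o, a, e⟩, hp⟩ := p
  rcases Int.units_eq_one_or e with rfl | rfl <;> cases o <;>
    simp [outputIndex, inputIndex, crossedToLeft,
      LinearCrossing.matrix, LinearCrossing.diag]

theorem crossingMap_mix (D : GaussCode) (B P : LinearCrossing R) (p : D.Arc) :
    D.crossingMap B.matrix P.matrix p (D.outputIndex p) (D.outputIndex p) =
      (D.weight B P p.1.label).mix p.1.isOver p.1.sign := by
  rw [crossingMap_eq]
  generalize D.weight B P p.1.label = c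
  rw [LinearCrossing.matrix_inv]
  obtain ⟨⟨o, a, e⟩, hp⟩ := p
  rcases Int.units_eq_one_or e with rfl | rfl <;> cases o <;>
    simp [outputIndex, crossedToLeft,
      LinearCrossing.matrix, LinearCrossing.mix]

theorem next_prev (D : GaussCode) (p : D.Arc) : D.next (D.prev p) = p :=
  Subtype.ext (List.next_prev _ D.nodup _ p.2)

theorem prev_next (D : GaussCode) (p : D.Arc) : D.prev (D.next p) = p :=
  Subtype.ext (List.prev_next _ D.nodup _ p.2)

theorem eq_prev_iff (D : GaussCode) {x p : D.Arc} : x = D.prev p ↔ (D.next x).1 = p.1 := by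
  constructor
  · rintro rfl
    rw [next_prev]
  · intro h
    rw [← Subtype.ext h, prev_next]

/-- The arc `x` is the one leading into `p` exactly when `next x = p`, so the two incoming arcs of a
relation become conditions on `next x`. -/
theorem relationMatrix_eq (D : GaussCode) (B P : LinearCrossing R) :
    D.relationMatrix B.matrix P.matrix =
      cyclicMatrix D.passages (passageCoeff (D.weight B P)) := by
  ext p x
  simp only [relationMatrix, crossingMap_diag, crossingMap_mix, eq_prev_iff, cyclicMatrix,
    passageCoeff, eq_comm (a := x) (b := p)]
  rfl

theorem polynomial_eq (D : GaussCode) (B P : LinearCrossing R) :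
    D.polynomial B.matrix P.matrix = cyclicDet D.passages (passageCoeff (D.weight B P)) := by
  simp only [polynomial, cyclicDet, relationMatrix_eq]

end GaussCode

theorem passageCoeff_congr {W W' : ℕ → LinearCrossing R} {l : List Passage}
    (h : ∀ p ∈ l, W p.label = W' p.label) :
    cyclicDet l (passageCoeff W) = cyclicDet l (passageCoeff W') :=
  cyclicDet_congr fun p hp y _ => by simp only [passageCoeff, h p hp]

/-- The conditions on the maps `B` and `P` for the invariance under the Reidemeister moves; either
none or two of the crossings of a third move are odd. -/
structure IsParityPair (B P : LinearCrossing R) : Prop where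
  loop : B.r = 1 - B.s * B.t
  even : B.Compatible B B
  odd_top_mid : P.Compatible B P
  odd_top : P.Compatible P B
  odd_bot : B.Compatible P P

namespace GaussCode

open Classical in
theorem compatible_weight {B P : LinearCrossing R} (h : IsParityPair B P) (D : GaussCode)
    {a b c : ℕ} (hp : (if D.IsOddLabel a then 1 else 0) + (if D.IsOddLabel b then 1 else 0) +
      (if D.IsOddLabel c then 1 else 0) ∈ ({0, 2} : Set ℕ)) :
    (D.weight B P a).Compatible (D.weight B P b) (D.weight B P c) := by
  have := h.even
  have := h.odd_top_mid
  have := h.odd_top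
  have := h.odd_bot
  unfold weight
  split_ifs at hp ⊢ <;> first | assumption | simp at hp

theorem polynomial_basePoint {B P : LinearCrossing R} {D D' : GaussCode} {u v : List Passage}
    (h : D.passages = u ++ v) (h' : D'.passages = v ++ u) :
    D'.polynomial B.matrix P.matrix = D.polynomial B.matrix P.matrix := by
  rw [polynomial_eq, polynomial_eq, h, h', ← cyclicDet_append_comm (by rw [← h]; exact D.nodup), ← h]
  have hmem : ∀ p, p ∈ D'.passages ↔ p ∈ D.passages := fun p => by
    rw [h, h', List.mem_append, List.mem_append, or_comm]
  refine passageCoeff_congr fun p hp => weight_eq ?_ B P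
  have key : ∀ q ∈ D.passages,
      D'.passages.idxOf q % 2 = (D.passages.idxOf q + u.length) % 2 := fun q hq => by
    have hn := D.nodup
    have he := D.even_length
    rw [h] at hq hn he
    rw [h, h']
    exact List.idxOf_append_comm hn he hq
  exact isOddLabel_iff_of_idxOf hp ((hmem p).2 hp) u.length (key p hp)
    (key _ (D.opposite_mem p hp))

theorem polynomial_renumber {B P : LinearCrossing R} {D D' : GaussCode} (f : Equiv.Perm ℕ)
    (h : D'.passages = D.passages.map fun p => ⟨p.isOver, f p.label, p.sign⟩) :
    D'.polynomial B.matrix P.matrix = D.polynomial B.matrix P.matrix := by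
  let F : Passage → Passage := fun p => ⟨p.isOver, f p.label, p.sign⟩
  have hF : Function.Injective F := by
    rintro ⟨o, a, e⟩ ⟨o', a', e'⟩ h
    simpa [F] using h
  have hop : ∀ p, (F p).opposite = F p.opposite := fun p => rfl
  have h : D'.passages = D.passages.map F := h
  rw [polynomial_eq, polynomial_eq, h, cyclicDet_map hF D.nodup]
  refine cyclicDet_congr fun p hp y _ => ?_
  have hp' : F p ∈ D'.passages := h ▸ List.mem_map_of_mem hp
  have hw : D'.weight B P (F p).label = D.weight B P p.label := by
    refine weight_eq ?_ B P
    rw [isOddLabel_label_iff D hp, isOddLabel_label_iff D' hp', h, hop,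
      List.idxOf_map_injective hF, List.idxOf_map_injective hF]
  simp only [passageCoeff, hw, hop, hF.eq_iff]
  rfl

theorem polynomial_one {B P : LinearCrossing R} (hBP : IsParityPair B P) {D D' : GaussCode}
    {o : Bool} {a : ℕ} {e : ℤˣ}
    (h : D'.passages = [⟨o, a, e⟩, ⟨!o, a, e⟩] ++ D.passages) :
    ∃ k : ℤ, D'.polynomial B.matrix P.matrix =
      ((B.s * B.t) ^ k : Rˣ) * D.polynomial B.matrix P.matrix := by
  have hA : (⟨o, a, e⟩ : Passage) ∈ D'.passages := by simp [h]
  have hn := D'.nodup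
  rw [h] at hn
  have hne : ∀ p ∈ D.passages, p ≠ ⟨o, a, e⟩ ∧ p ≠ ⟨!o, a, e⟩ := by
    intro p hp
    have h1 := List.nodup_cons.1 hn
    have h2 := List.nodup_cons.1 h1.2
    exact ⟨fun e => h1.1 (e ▸ List.mem_cons_of_mem _ hp), fun e => h2.1 (e ▸ hp)⟩
  have hmem : ∀ p ∈ D.passages, p ∈ D'.passages := fun p hp => by simp [h, hp]
  have hlab : ∀ p ∈ D.passages, p.label ≠ a := fun p hp =>
    D'.label_ne_of_notMem (hmem p hp) hA (hne p hp).1 (hne p hp).2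
  -- The two passages stand at positions 0 and 1, with nothing between them.
  have hodd : ¬ D'.IsOddLabel a := by
    have := isOddLabel_label_iff D' hA
    simp only at this
    rw [this, h]
    simp [Passage.opposite, List.idxOf_cons_ne]
  have hW : D'.weight B P a = B := by simp [weight, hodd]
  obtain ⟨k, hk⟩ := cyclicDet_one o a e D.passages hn hlab (D'.weight B P)
    (by rw [hW]; exact hBP.loop)
  refine ⟨k, ?_⟩
  rw [polynomial_eq, polynomial_eq, h]
  rw [hW] at hk
  refine hk.trans ?_
  congr 1
  refine passageCoeff_congr fun p hp => weight_eq ?_ B P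
  have key : ∀ p ∈ D.passages,
      D'.passages.idxOf p % 2 = (D.passages.idxOf p + 0) % 2 := fun p hp => by
    rw [h]
    exact List.idxOf_insert_pair (hne p hp).1 (hne p hp).2 [] D.passages
  exact isOddLabel_iff_of_idxOf hp (hmem p hp) 0 (key p hp) (key _ (D.opposite_mem p hp))

end GaussCode

end Polynomial

/-! ### Invariance under the second and third moves, and on virtual knots -/

section Moves

variable {R : Type*} [CommRing R]

namespace GaussCode

theorem polynomial_two {B P : LinearCrossing R} {D D' : GaussCode}
    {o : ℤˣ} {a b : ℕ} {e : ℤˣ} {u v : List Passage} (h : D.passages = u ++ v)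
    (h' : D'.passages = [⟨true, a, e⟩, ⟨true, b, -e⟩] ++ u ++
      orderedPair o ⟨false, a, e⟩ ⟨false, b, -e⟩ ++ v) :
    D'.polynomial B.matrix P.matrix = D.polynomial B.matrix P.matrix := by
  have hn := D'.nodup
  rw [h'] at hn
  have hn2 : ((([⟨true, a, e⟩, ⟨true, b, -e⟩] : List Passage) ++ u) ++
      (orderedPair o ⟨false, a, e⟩ ⟨false, b, -e⟩ ++ v)).Nodup := by
    simpa only [List.append_assoc] using hn
  have hperm : D'.passages.Perm ([⟨true, a, e⟩, ⟨true, b, -e⟩, ⟨false, a, e⟩, ⟨false, b, -e⟩] ++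
      (u ++ v)) := by
    rw [h', List.perm_iff_count]
    intro x
    simp only [List.count_append, (orderedPair_perm o _ _).count_eq, List.count_cons,
      List.count_nil]
    ring
  have hd := (List.nodup_append.1 (hperm.nodup_iff.1 D'.nodup)).2.2
  have hmem : ∀ p ∈ u ++ v, p ∈ D'.passages := fun p hp =>
    hperm.mem_iff.2 (List.mem_append_right _ hp)
  have hA : (⟨true, a, e⟩ : Passage) ∈ D'.passages := hperm.mem_iff.2 (by simp)
  have hB : (⟨true, b, -e⟩ : Passage) ∈ D'.passages := hperm.mem_iff.2 (by simp)
  have hab : a ≠ b := by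
    have h1 : (⟨true, a, e⟩ : Passage) ≠ ⟨true, b, -e⟩ := by simp
    exact D'.label_ne_of_notMem hA hB h1 (by simp [Passage.opposite])
  have hlab : ∀ p ∈ u ++ v, p.label ≠ a ∧ p.label ≠ b := fun p hp =>
    ⟨D'.label_ne_of_notMem (hmem p hp) hA
        (fun h => hd _ (by simp) p hp h.symm) (fun h => hd _ (by simp [Passage.opposite]) p hp h.symm),
      D'.label_ne_of_notMem (hmem p hp) hB
        (fun h => hd _ (by simp) p hp h.symm) (fun h => hd _ (by simp [Passage.opposite]) p hp h.symm)⟩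
  have hW : D'.weight B P a = D'.weight B P b := by
    refine weight_eq ?_ B P
    have e1 := isOddLabel_label_iff D' hA
    have e2 := isOddLabel_label_iff D' hB
    simp only [Passage.opposite, Bool.not_true] at e1 e2
    rw [e1, e2]
    -- Both the over passages and the under passages of the two crossings are adjacent, so the four
    -- positions have an even sum and the crossings have equal parity.
    have h3 := idxOf_orderedPair_add hn2
    have h1 : D'.passages.idxOf (⟨true, a, e⟩ : Passage) = 0 := by simp [h']
    have h2 : D'.passages.idxOf (⟨true, b, -e⟩ : Passage) = 1 := by
      simp [h', List.idxOf_cons_ne, hab]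
    have h4 : D'.passages = ([⟨true, a, e⟩, ⟨true, b, -e⟩] ++ u) ++
      (orderedPair o ⟨false, a, e⟩ ⟨false, b, -e⟩ ++ v) := by rw [h']; simp only [List.append_assoc]
    rw [← h4] at h3
    omega
  rw [polynomial_eq, polynomial_eq, h, h', cyclicDet_two o hab e u v hn hlab _ hW]
  refine passageCoeff_congr fun p hp => weight_eq ?_ B P
  have hopp : ∀ p ∈ u ++ v, p.opposite ∈ u ++ v := fun p hp => by
    rw [← h] at hp ⊢
    exact D.opposite_mem p hp
  have key : ∀ p ∈ u ++ v,
      D'.passages.idxOf p % 2 = (D.passages.idxOf p + 0) % 2 := fun p hp => by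
    obtain ⟨hpa, hpb⟩ := hlab p hp
    have ha : ∀ o e, p ≠ ⟨o, a, e⟩ := fun o e h => hpa (by rw [h])
    have hb : ∀ o e, p ≠ ⟨o, b, e⟩ := fun o e h => hpb (by rw [h])
    rw [h, h', add_zero]
    have h1 : orderedPair o (⟨false, a, e⟩ : Passage) ⟨false, b, -e⟩ =
      [if o = 1 then ⟨false, a, e⟩ else ⟨false, b, -e⟩,
        if o = 1 then ⟨false, b, -e⟩ else ⟨false, a, e⟩] := orderedPair_eq _ _ _
    rw [h1, List.idxOf_insert_pair (by split_ifs <;> simp [ha, hb])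
      (by split_ifs <;> simp [ha, hb]), List.append_assoc]
    exact List.idxOf_insert_pair (ha _ _) (hb _ _) [] (u ++ v)
  have hp' : p ∈ D.passages := by rwa [h]
  exact isOddLabel_iff_of_idxOf hp' (hmem p hp) 0 (key p hp) (key _ (hopp p hp))

/-- The effect of a third move, in any order of the three strands, on parities and labels. -/
theorem weight_three {D D' : GaussCode} {a b c : ℕ} {ea eb ec : ℤˣ}
    (hmem : ∀ p ∈ D'.passages, p ∈ D.passages)
    (hA : (⟨true, a, ea⟩ : Passage) ∈ D.passages) (hB : (⟨true, b, eb⟩ : Passage) ∈ D.passages)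
    (hC : (⟨true, c, ec⟩ : Passage) ∈ D.passages)
    (hn : ([⟨true, a, ea⟩, ⟨true, b, eb⟩, ⟨true, c, ec⟩] : List Passage).Nodup)
    (htop : (D.passages.idxOf (⟨true, a, ea⟩ : Passage) +
      D.passages.idxOf (⟨true, b, eb⟩ : Passage)) % 2 = 1)
    (hmid : (D.passages.idxOf (⟨false, a, ea⟩ : Passage) +
      D.passages.idxOf (⟨true, c, ec⟩ : Passage)) % 2 = 1)
    (hbot : (D.passages.idxOf (⟨false, b, eb⟩ : Passage) +
      D.passages.idxOf (⟨false, c, ec⟩ : Passage)) % 2 = 1)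
    (hidx : ∀ p, D'.passages.idxOf p % 2 = (D.passages.idxOf p +
      ((if p = ⟨true, a, ea⟩ ∨ p = ⟨true, b, eb⟩ then 1 else 0) +
      (if p = ⟨false, a, ea⟩ ∨ p = ⟨true, c, ec⟩ then 1 else 0) +
      if p = ⟨false, b, eb⟩ ∨ p = ⟨false, c, ec⟩ then 1 else 0)) % 2)
    {B P : LinearCrossing R} (hBP : IsParityPair B P) :
    a ≠ b ∧ a ≠ c ∧ b ≠ c ∧
      (D.weight B P a).Compatible (D.weight B P b) (D.weight B P c) ∧
      cyclicDet D'.passages (passageCoeff (D'.weight B P)) =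
        cyclicDet D'.passages (passageCoeff (D.weight B P)) := by
  have hne : ∀ {x y : ℕ} {ex ey : ℤˣ}, (⟨true, x, ex⟩ : Passage) ∈ D.passages →
      (⟨true, y, ey⟩ : Passage) ∈ D.passages → (⟨true, x, ex⟩ : Passage) ≠ ⟨true, y, ey⟩ →
      x ≠ y := fun hx hy hxy => D.label_ne_of_notMem hx hy hxy (by simp [Passage.opposite])
  simp only [List.nodup_cons, List.mem_cons, List.not_mem_nil, or_false, not_or] at hn
  have hab : a ≠ b := hne hA hB hn.1.1
  have hac : a ≠ c := hne hA hC hn.1.2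
  have hbc : b ≠ c := hne hB hC hn.2.1
  refine ⟨hab, hac, hbc, compatible_weight hBP D ?_, ?_⟩
  -- The three adjacent pairs give the six positions an odd sum. A crossing is even exactly when its
  -- own two positions have an odd sum, so the number of even crossings is odd, and none or two are
  -- odd.
  · have e1 := isOddLabel_label_iff D hA
    have e2 := isOddLabel_label_iff D hB
    have e3 := isOddLabel_label_iff D hC
    simp only [Passage.opposite, Bool.not_true] at e1 e2 e3
    simp only [e1, e2, e3]
    split_ifs <;> simp <;> omega
  · refine passageCoeff_congr fun p hp => weight_eq ?_ B P
    refine isOddLabel_iff_of_idxOf (hmem p hp) hp _ (hidx p) ((hidx p.opposite).trans ?_)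
    -- A crossing has both of its passages among the six or neither, so both of its positions are
    -- shifted by the same amount modulo 2.
    congr 2
    obtain ⟨o, n, e⟩ := p
    simp only [Passage.opposite, Passage.mk.injEq]
    by_cases h1 : n = a
    · subst h1
      cases o <;> simp [hab, hac]
    · by_cases h2 : n = b
      · subst h2
        cases o <;> simp [h1, hbc]
      · cases o <;> simp [h1, h2]

theorem polynomial_three_top_mid_bot {B P : LinearCrossing R} (hBP : IsParityPair B P)
    {D D' : GaussCode} {a b c : ℕ} {ea eb ec α β γ : ℤˣ}
    (hβ : β = α * eb * ec) (hγ : γ = α * ea * ec) {u v w : List Passage}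
    (h : D.passages = orderedPair α ⟨true, a, ea⟩ ⟨true, b, eb⟩ ++ u ++
          orderedPair β ⟨false, a, ea⟩ ⟨true, c, ec⟩ ++ v ++
          orderedPair γ ⟨false, b, eb⟩ ⟨false, c, ec⟩ ++ w)
    (h' : D'.passages = orderedPair (-α) ⟨true, a, ea⟩ ⟨true, b, eb⟩ ++ u ++
          orderedPair (-β) ⟨false, a, ea⟩ ⟨true, c, ec⟩ ++ v ++
          orderedPair (-γ) ⟨false, b, eb⟩ ⟨false, c, ec⟩ ++ w) :
    D'.polynomial B.matrix P.matrix = D.polynomial B.matrix P.matrix := by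
  have hn := D.nodup
  rw [h] at hn
  have hperm : D.passages.Perm ([⟨true, a, ea⟩, ⟨true, b, eb⟩, ⟨true, c, ec⟩] ++
      ([⟨false, a, ea⟩, ⟨false, b, eb⟩, ⟨false, c, ec⟩] ++ (u ++ v ++ w))) := by
    rw [h, List.perm_iff_count]
    intro x
    simp only [List.count_append, (orderedPair_perm _ _ _).count_eq, List.count_cons,
      List.count_nil]
    ring
  obtain ⟨hab, hac, hbc, hcomp, hw⟩ := weight_three (D := D) (D' := D')
    (a := a) (b := b) (c := c) (ea := ea) (eb := eb) (ec := ec)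
    (fun p hp => by
      simp only [h, h', List.mem_append, mem_orderedPair] at hp ⊢
      exact hp)
    (hperm.mem_iff.2 (by simp)) (hperm.mem_iff.2 (by simp)) (hperm.mem_iff.2 (by simp))
    (List.nodup_append.1 (hperm.nodup_iff.1 D.nodup)).1
    (by
      have := idxOf_orderedPair_add (α := α) (a := ⟨true, a, ea⟩) (b := ⟨true, b, eb⟩) (x := [])
        (by simpa only [List.append_assoc, List.nil_append] using hn)
      simpa only [h, List.append_assoc, List.nil_append] using this)
    (by
      have := idxOf_orderedPair_add (α := β) (a := ⟨false, a, ea⟩) (b := ⟨true, c, ec⟩)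
        (x := orderedPair α ⟨true, a, ea⟩ ⟨true, b, eb⟩ ++ u)
        (by simpa only [List.append_assoc, List.nil_append] using hn)
      simpa only [h, List.append_assoc, List.nil_append] using this)
    (by
      have := idxOf_orderedPair_add (α := γ) (a := ⟨false, b, eb⟩) (b := ⟨false, c, ec⟩)
        (x := orderedPair α ⟨true, a, ea⟩ ⟨true, b, eb⟩ ++ u ++
          orderedPair β ⟨false, a, ea⟩ ⟨true, c, ec⟩ ++ v)
        (by simpa only [List.append_assoc, List.nil_append] using hn)
      simpa only [h, List.append_assoc, List.nil_append] using this)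
    (fun p => by
      -- The pairs are reversed one at a time from the end of the code, so `h2` and `h1` speak of
      -- lists in which the later pairs are already reversed.
      have h3 := idxOf_orderedPair_neg (p := p) (α := γ) (a := ⟨false, b, eb⟩)
        (b := ⟨false, c, ec⟩) (y := w)
        (x := orderedPair α ⟨true, a, ea⟩ ⟨true, b, eb⟩ ++ u ++
          orderedPair β ⟨false, a, ea⟩ ⟨true, c, ec⟩ ++ v)
        (by simpa only [List.append_assoc, List.nil_append] using hn)
      have h2 := idxOf_orderedPair_neg (p := p) (α := β) (a := ⟨false, a, ea⟩)
        (b := ⟨true, c, ec⟩) (y := v ++ orderedPair (-γ) ⟨false, b, eb⟩ ⟨false, c, ec⟩ ++ w)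
        (x := orderedPair α ⟨true, a, ea⟩ ⟨true, b, eb⟩ ++ u)
        (by
          refine (List.Perm.nodup_iff ?_).1 hn
          rw [List.perm_iff_count]
          intro x
          simp only [List.count_append, (orderedPair_perm _ _ _).count_eq]
          ring)
      have h1 := idxOf_orderedPair_neg (p := p) (α := α) (a := ⟨true, a, ea⟩)
        (b := ⟨true, b, eb⟩) (y := u ++ orderedPair (-β) ⟨false, a, ea⟩ ⟨true, c, ec⟩ ++ v ++
          orderedPair (-γ) ⟨false, b, eb⟩ ⟨false, c, ec⟩ ++ w) (x := [])
        (by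
          refine (List.Perm.nodup_iff ?_).1 hn
          rw [List.perm_iff_count]
          intro x
          simp only [List.count_append, (orderedPair_perm _ _ _).count_eq]
          simp only [List.count_nil]
          ring)
      simp only [h, h', List.append_assoc, List.nil_append] at h1 h2 h3 ⊢
      omega) hBP
  rw [polynomial_eq, polynomial_eq, hw, h, h']
  exact cyclicDet_three_top_mid_bot hab hac hbc hβ hγ hcomp hn

theorem polynomial_three_top_bot_mid {B P : LinearCrossing R} (hBP : IsParityPair B P)
    {D D' : GaussCode} {a b c : ℕ} {ea eb ec α β γ : ℤˣ}
    (hβ : β = α * eb * ec) (hγ : γ = α * ea * ec) {u v w : List Passage}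
    (h : D.passages = orderedPair α ⟨true, a, ea⟩ ⟨true, b, eb⟩ ++ u ++
          orderedPair γ ⟨false, b, eb⟩ ⟨false, c, ec⟩ ++ v ++
          orderedPair β ⟨false, a, ea⟩ ⟨true, c, ec⟩ ++ w)
    (h' : D'.passages = orderedPair (-α) ⟨true, a, ea⟩ ⟨true, b, eb⟩ ++ u ++
          orderedPair (-γ) ⟨false, b, eb⟩ ⟨false, c, ec⟩ ++ v ++
          orderedPair (-β) ⟨false, a, ea⟩ ⟨true, c, ec⟩ ++ w) :
    D'.polynomial B.matrix P.matrix = D.polynomial B.matrix P.matrix := by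
  have hn := D.nodup
  rw [h] at hn
  have hperm : D.passages.Perm ([⟨true, a, ea⟩, ⟨true, b, eb⟩, ⟨true, c, ec⟩] ++
      ([⟨false, a, ea⟩, ⟨false, b, eb⟩, ⟨false, c, ec⟩] ++ (u ++ v ++ w))) := by
    rw [h, List.perm_iff_count]
    intro x
    simp only [List.count_append, (orderedPair_perm _ _ _).count_eq, List.count_cons,
      List.count_nil]
    ring
  obtain ⟨hab, hac, hbc, hcomp, hw⟩ := weight_three (D := D) (D' := D')
    (a := a) (b := b) (c := c) (ea := ea) (eb := eb) (ec := ec)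
    (fun p hp => by
      simp only [h, h', List.mem_append, mem_orderedPair] at hp ⊢
      exact hp)
    (hperm.mem_iff.2 (by simp)) (hperm.mem_iff.2 (by simp)) (hperm.mem_iff.2 (by simp))
    (List.nodup_append.1 (hperm.nodup_iff.1 D.nodup)).1
    (by
      have := idxOf_orderedPair_add (α := α) (a := ⟨true, a, ea⟩) (b := ⟨true, b, eb⟩) (x := [])
        (by simpa only [List.append_assoc, List.nil_append] using hn)
      simpa only [h, List.append_assoc, List.nil_append] using this)
    (by
      have := idxOf_orderedPair_add (α := β) (a := ⟨false, a, ea⟩) (b := ⟨true, c, ec⟩)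
        (x := orderedPair α ⟨true, a, ea⟩ ⟨true, b, eb⟩ ++ u ++
          orderedPair γ ⟨false, b, eb⟩ ⟨false, c, ec⟩ ++ v)
        (by simpa only [List.append_assoc, List.nil_append] using hn)
      simpa only [h, List.append_assoc, List.nil_append] using this)
    (by
      have := idxOf_orderedPair_add (α := γ) (a := ⟨false, b, eb⟩) (b := ⟨false, c, ec⟩)
        (x := orderedPair α ⟨true, a, ea⟩ ⟨true, b, eb⟩ ++ u)
        (by simpa only [List.append_assoc, List.nil_append] using hn)
      simpa only [h, List.append_assoc, List.nil_append] using this)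
    (fun p => by
      have h3 := idxOf_orderedPair_neg (p := p) (α := β) (a := ⟨false, a, ea⟩)
        (b := ⟨true, c, ec⟩) (y := w)
        (x := orderedPair α ⟨true, a, ea⟩ ⟨true, b, eb⟩ ++ u ++
          orderedPair γ ⟨false, b, eb⟩ ⟨false, c, ec⟩ ++ v)
        (by simpa only [List.append_assoc, List.nil_append] using hn)
      have h2 := idxOf_orderedPair_neg (p := p) (α := γ) (a := ⟨false, b, eb⟩)
        (b := ⟨false, c, ec⟩) (y := v ++ orderedPair (-β) ⟨false, a, ea⟩ ⟨true, c, ec⟩ ++ w)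
        (x := orderedPair α ⟨true, a, ea⟩ ⟨true, b, eb⟩ ++ u)
        (by
          refine (List.Perm.nodup_iff ?_).1 hn
          rw [List.perm_iff_count]
          intro x
          simp only [List.count_append, (orderedPair_perm _ _ _).count_eq]
          ring)
      have h1 := idxOf_orderedPair_neg (p := p) (α := α) (a := ⟨true, a, ea⟩)
        (b := ⟨true, b, eb⟩) (y := u ++ orderedPair (-γ) ⟨false, b, eb⟩ ⟨false, c, ec⟩ ++ v ++
          orderedPair (-β) ⟨false, a, ea⟩ ⟨true, c, ec⟩ ++ w) (x := [])
        (by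
          refine (List.Perm.nodup_iff ?_).1 hn
          rw [List.perm_iff_count]
          intro x
          simp only [List.count_append, (orderedPair_perm _ _ _).count_eq]
          simp only [List.count_nil]
          ring)
      simp only [h, h', List.append_assoc, List.nil_append] at h1 h2 h3 ⊢
      omega) hBP
  rw [polynomial_eq, polynomial_eq, hw, h, h']
  exact cyclicDet_three_top_bot_mid hab hac hbc hβ hγ hcomp hn

/-- The polynomial of a parity pair is an invariant of virtual knots, up to powers of `s t`. -/
theorem polynomial_of_move {B P : LinearCrossing R} (hBP : IsParityPair B P) {D D' : GaussCode}
    (h : ReidemeisterMove D.passages D'.passages) :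
    ∃ k : ℤ, D'.polynomial B.matrix P.matrix =
      ((B.s * B.t) ^ k : Rˣ) * D.polynomial B.matrix P.matrix := by
  have h0 : D'.polynomial B.matrix P.matrix = D.polynomial B.matrix P.matrix →
      ∃ k : ℤ, D'.polynomial B.matrix P.matrix =
      ((B.s * B.t) ^ k : Rˣ) * D.polynomial B.matrix P.matrix := fun h => ⟨0, by simp [h]⟩
  generalize hl : D.passages = l at h
  generalize hl' : D'.passages = l' at h
  cases h with
  | basePoint u v => exact h0 (polynomial_basePoint hl hl')
  | renumber f => exact h0 (polynomial_renumber f (by rw [hl', hl]))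
  | one o a e => exact polynomial_one hBP (by rw [hl', hl])
  | two o a b e u v => exact h0 (polynomial_two hl hl')
  | three_top_mid_bot a b c ea eb ec α β γ hβ hγ u v w =>
    exact h0 (polynomial_three_top_mid_bot hBP hβ hγ hl hl')
  | three_top_bot_mid a b c ea eb ec α β γ hβ hγ u v w =>
    exact h0 (polynomial_three_top_bot_mid hBP hβ hγ hl hl')

theorem polynomial_of_knot_eq {B P : LinearCrossing R} (hBP : IsParityPair B P) {D D' : GaussCode}
    (h : D.knot = D'.knot) :
    ∃ k : ℤ, D'.polynomial B.matrix P.matrix =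
      ((B.s * B.t) ^ k : Rˣ) * D.polynomial B.matrix P.matrix := by
  have e := Quot.eqvGen_exact h
  clear h
  induction e with
  | rel D D' h => exact polynomial_of_move hBP h
  | refl D => exact ⟨0, by simp⟩
  | symm D D' _ ih =>
    obtain ⟨k, hk⟩ := ih
    refine ⟨-k, ?_⟩
    rw [hk, ← mul_assoc, ← Units.val_mul, ← zpow_add]
    simp
  | trans D D' D'' _ _ ih ih' =>
    obtain ⟨k, hk⟩ := ih
    obtain ⟨m, hm⟩ := ih'
    refine ⟨m + k, ?_⟩
    rw [hm, hk, ← mul_assoc, ← Units.val_mul, ← zpow_add]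

end GaussCode

end Moves

/-! ### Classical diagrams -/

namespace GaussCode

theorem opp_opp (D : GaussCode) (p : D.Arc) : D.opp (D.opp p) = p :=
  Subtype.ext p.1.opposite_opposite

theorem opp_ne (D : GaussCode) (p : D.Arc) : D.opp p ≠ p := fun h =>
  p.1.opposite_ne (congrArg Subtype.val h)

theorem crossedToLeft_opp (D : GaussCode) (p : D.Arc) :
    D.crossedToLeft (D.opp p) = !D.crossedToLeft p := by
  obtain ⟨⟨o, a, e⟩, hp⟩ := p
  cases o <;> simp [crossedToLeft, opp, Passage.opposite]

theorem next_getElem (D : GaussCode) (i : ℕ) (hi : i + 1 < D.passages.length) :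
    D.next ⟨D.passages[i], List.getElem_mem _⟩ = ⟨D.passages[i + 1], List.getElem_mem _⟩ := by
  refine Subtype.ext ?_
  have := List.next_getElem D.passages D.nodup i (by omega)
  simp only [next, this, Nat.mod_eq_of_lt hi]

/-- A knot has one component: all arcs form a single cycle. This plays the part of connectedness of
the diagram and of the surface. -/
theorem eq_of_next_eq {D : GaussCode} {ι : Type*} {g : D.Arc → ι}
    (h : ∀ p, g (D.next p) = g p) (p q : D.Arc) : g p = g q := by
  have key : ∀ i (hi : i < D.passages.length),
      g ⟨D.passages[i], List.getElem_mem _⟩ = g ⟨D.passages[0], List.getElem_mem _⟩ := by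
    intro i
    induction i with
    | zero => intro hi; rfl
    | succ i ih =>
      intro hi
      rw [← next_getElem D i hi, h, ih (by omega)]
  obtain ⟨p, hp⟩ := p
  obtain ⟨q, hq⟩ := q
  obtain ⟨i, hi, rfl⟩ := List.getElem_of_mem hp
  obtain ⟨j, hj, rfl⟩ := List.getElem_of_mem hq
  rw [key i hi, key j hj]

/-- The face on the left of an arc. -/
def leftFace (D : GaussCode) (p : D.Arc) : D.Face := Quot.mk _ (p, true)

/-- The face on the right of an arc. -/
def rightFace (D : GaussCode) (p : D.Arc) : D.Face := Quot.mk _ (p, false)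

section Corners

variable {D : GaussCode} {p : D.Arc}

theorem leftFace_opp (hp : D.crossedToLeft p = true) :
    D.leftFace (D.opp p) = D.leftFace (D.prev p) := by
  refine (Quot.sound ?_).symm
  simp [turnLeft, next_prev, hp]

theorem leftFace_prev_opp (hp : D.crossedToLeft p = true) :
    D.leftFace (D.prev (D.opp p)) = D.rightFace (D.prev p) := by
  refine Quot.sound ?_
  simp [turnLeft, next_prev, crossedToLeft_opp, hp, opp_opp]

theorem rightFace_prev_opp (hp : D.crossedToLeft p = true) :
    D.rightFace (D.prev (D.opp p)) = D.rightFace p := by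
  refine (Quot.sound ?_).symm
  simp [turnLeft, hp]

theorem rightFace_opp (hp : D.crossedToLeft p = true) :
    D.rightFace (D.opp p) = D.leftFace p := by
  refine Quot.sound ?_
  simp [turnLeft, crossedToLeft_opp, hp, opp_opp]

end Corners

instance (D : GaussCode) : Finite D.Face :=
  inferInstanceAs (Finite (Quot _))

/-- The crossings, represented by their over passages. -/
abbrev Crossing (D : GaussCode) : Type := {p : D.Arc // p.1.isOver = true}

/-- The crossing of a passage. -/
def crossing (D : GaussCode) (p : D.Arc) : D.Crossing :=
  if h : p.1.isOver = true then ⟨p, h⟩ else ⟨D.opp p, by simpa [opp, Passage.opposite] using h⟩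

theorem crossing_opp (D : GaussCode) (p : D.Arc) : D.crossing (D.opp p) = D.crossing p := by
  obtain ⟨⟨o, a, e⟩, hp⟩ := p
  cases o <;> simp [crossing, opp, Passage.opposite]

theorem crossing_over (D : GaussCode) (x : D.Crossing) : D.crossing x.1 = x := by
  simp [crossing, x.2]

theorem two_mul_card_crossing (D : GaussCode) :
    2 * Fintype.card D.Crossing = Fintype.card D.Arc := by
  have h : Fintype.card {p : D.Arc // ¬ p.1.isOver = true} = Fintype.card D.Crossing := by
    refine Fintype.card_congr ⟨fun p => ⟨D.opp p.1, ?_⟩, fun p => ⟨D.opp p.1, ?_⟩, ?_, ?_⟩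
    · simpa [opp, Passage.opposite] using p.2
    · simpa [opp, Passage.opposite] using p.2
    · exact fun p => Subtype.ext (D.opp_opp p.1)
    · exact fun p => Subtype.ext (D.opp_opp p.1)
  have := Fintype.card_congr (Equiv.sumCompl fun p : D.Arc => p.1.isOver = true)
  rw [Fintype.card_sum, h] at this
  rw [← this, two_mul]

theorem card_arc (D : GaussCode) : Fintype.card D.Arc = D.passages.length := by
  rw [← List.toFinset_card_of_nodup D.nodup]
  exact Fintype.card_of_subtype _ fun p => List.mem_toFinset

/-- The difference of a function on the faces across the arcs. -/
def faceDifference (D : GaussCode) : (D.Face → ℚ) →ₗ[ℚ] (D.Arc → ℚ) where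
  toFun f p := f (D.leftFace p) - f (D.rightFace p)
  map_add' f g := by ext p; simp; ring
  map_smul' c f := by ext p; simp; ring

theorem faceDifference_add_opp (D : GaussCode) (f : D.Face → ℚ) (p : D.Arc) :
    (D.faceDifference f (D.prev p) - D.faceDifference f p) +
      (D.faceDifference f (D.prev (D.opp p)) - D.faceDifference f (D.opp p)) = 0 := by
  wlog hp : D.crossedToLeft p = true generalizing p
  · have := this (D.opp p) (by simpa [crossedToLeft_opp] using hp)
    rw [opp_opp] at this
    linarith
  simp only [faceDifference, LinearMap.coe_mk, AddHom.coe_mk, leftFace_opp hp,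
    leftFace_prev_opp hp, rightFace_prev_opp hp, rightFace_opp hp]
  ring

/-- The incidence matrix of arcs and crossings. -/
def incidence (D : GaussCode) : Matrix D.Arc D.Crossing ℚ := fun p x =>
  (if D.crossing (D.next p) = x then 1 else 0) - if D.crossing p = x then 1 else 0

theorem incidence_mulVec (D : GaussCode) (g : D.Crossing → ℚ) (p : D.Arc) :
    (D.incidence.mulVec g) p = g (D.crossing (D.next p)) - g (D.crossing p) := by
  simp [Matrix.mulVec, dotProduct, incidence, sub_mul, Finset.sum_sub_distrib]

/-- The permutation of the arcs along the knot. -/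
def nextPerm (D : GaussCode) : Equiv.Perm D.Arc := ⟨D.next, D.prev, D.prev_next, D.next_prev⟩

/-- Summation by parts along the knot. -/
theorem dotProduct_incidence (D : GaussCode) (c : D.Arc → ℚ) (g : D.Crossing → ℚ) :
    c ⬝ᵥ (D.incidence.mulVec g) = ∑ p, (c (D.prev p) - c p) * g (D.crossing p) := by
  simp only [dotProduct, incidence_mulVec, mul_sub, sub_mul, Finset.sum_sub_distrib]
  congr 1
  rw [← Equiv.sum_comp D.nextPerm fun p => c (D.prev p) * g (D.crossing p)]
  refine Finset.sum_congr rfl fun p _ => ?_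
  simp [nextPerm, prev_next]

/-- The hypothesis is Kirchhoff's law at each crossing: the incoming coefficients have the same sum
as the outgoing ones. Thus `c` is a 1-cycle. -/
theorem vecMul_incidence_eq_zero {D : GaussCode} {c : D.Arc → ℚ}
    (hc : ∀ p, (c (D.prev p) - c p) + (c (D.prev (D.opp p)) - c (D.opp p)) = 0) :
    Matrix.mulVecLin (Matrix.transpose D.incidence) c = 0 := by
  rw [Matrix.mulVecLin_apply, Matrix.mulVec_transpose]
  refine dotProduct_eq_zero _ fun g => ?_
  rw [← Matrix.dotProduct_mulVec, dotProduct_incidence]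
  refine Finset.sum_involution (fun p _ => D.opp p) (fun p _ => ?_) (fun p _ _ => D.opp_ne p)
    (fun p _ => Finset.mem_univ _) (fun p _ => D.opp_opp p)
  rw [crossing_opp, ← add_mul, hc, zero_mul]

theorem finrank_le_one_of_forall_const {α : Type*} [Fintype α]
    (S : Submodule ℚ (α → ℚ)) (h : ∀ f ∈ S, ∀ x y, f x = f y) : Module.finrank ℚ S ≤ 1 := by
  rcases isEmpty_or_nonempty α with hα | ⟨⟨x⟩⟩
  · exact (Submodule.finrank_le S).trans (by simp)
  · refine (Submodule.finrank_mono (t := Submodule.span ℚ {fun _ => 1}) fun f hf => ?_).trans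
      ((finrank_span_le_card _).trans (by simp))
    exact Submodule.mem_span_singleton.2 ⟨f x, funext fun y => by simp [h f hf y x]⟩

/-- `faceDifference` is the boundary map on 2-chains. A function in its kernel agrees across every
arc, hence is constant, so boundaries have dimension at least `F - 1`. -/
theorem finrank_range_faceDifference (D : GaussCode) :
    Nat.card D.Face ≤ Module.finrank ℚ (LinearMap.range D.faceDifference) + 1 := by
  have := Fintype.ofFinite D.Face
  have h1 := LinearMap.finrank_range_add_finrank_ker D.faceDifference
  rw [Module.finrank_fintype_fun_eq_card] at h1
  rw [Nat.card_eq_fintype_card]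
  have h2 : Module.finrank ℚ (LinearMap.ker D.faceDifference) ≤ 1 := by
    refine finrank_le_one_of_forall_const _ fun f hf => ?_
    have h0 : ∀ p, f (D.leftFace p) = f (D.rightFace p) := fun p =>
      sub_eq_zero.1 (congrFun (LinearMap.mem_ker.1 hf) p)
    have hnext : ∀ p, f (D.leftFace (D.next p)) = f (D.leftFace p) := by
      have key : ∀ p, D.crossedToLeft p = true →
          f (D.leftFace p) = f (D.leftFace (D.prev p)) ∧
          f (D.leftFace (D.opp p)) = f (D.leftFace (D.prev (D.opp p))) := fun p hp =>
        ⟨by rw [← rightFace_opp hp, ← h0, leftFace_opp hp],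
          by rw [leftFace_opp hp, leftFace_prev_opp hp, h0]⟩
      intro p
      have hp : ∀ q, f (D.leftFace q) = f (D.leftFace (D.prev q)) := by
        intro q
        by_cases hq : D.crossedToLeft q = true
        · exact (key q hq).1
        · have := (key (D.opp q) (by simpa [crossedToLeft_opp] using hq)).2
          rwa [opp_opp] at this
      rw [hp, prev_next]
    have hc := eq_of_next_eq (g := fun p => f (D.leftFace p)) hnext
    have hl : ∀ x : D.Face, ∃ p, f x = f (D.leftFace p) := by
      rintro ⟨p, b⟩
      cases b
      · exact ⟨p, (h0 p).symm⟩
      · exact ⟨p, rfl⟩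
    intro x y
    obtain ⟨p, hp⟩ := hl x
    obtain ⟨q, hq⟩ := hl y
    rw [hp, hq]
    exact hc p q
  omega

/-- A function on the crossings with equal values at the ends of every arc is constant, so the
incidence matrix has rank at least `V - 1`, and cycles have dimension at most `E - V + 1`. -/
theorem finrank_ker_incidence (D : GaussCode) :
    Module.finrank ℚ (LinearMap.ker (Matrix.mulVecLin (Matrix.transpose D.incidence))) +
      Fintype.card D.Crossing ≤ Fintype.card D.Arc + 1 := by
  have h1 := LinearMap.finrank_range_add_finrank_ker
    (Matrix.mulVecLin (Matrix.transpose D.incidence))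
  have h2 := LinearMap.finrank_range_add_finrank_ker (Matrix.mulVecLin D.incidence)
  have h3 := Matrix.rank_transpose D.incidence
  unfold Matrix.rank at h3
  rw [Module.finrank_fintype_fun_eq_card] at h1 h2
  have h4 : Module.finrank ℚ (LinearMap.ker (Matrix.mulVecLin D.incidence)) ≤ 1 := by
    refine finrank_le_one_of_forall_const _ fun g hg x y => ?_
    have h0 : ∀ p, g (D.crossing (D.next p)) = g (D.crossing p) := fun p => by
      have := congrFun (LinearMap.mem_ker.1 hg) p
      rw [Matrix.mulVecLin_apply, incidence_mulVec] at this
      exact sub_eq_zero.1 this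
    have := eq_of_next_eq (g := fun p => g (D.crossing p)) h0 x.1 y.1
    simpa only [crossing_over] using this
  omega

/-- An Alexander numbering of the arcs: at every crossing the numbers to the left of the strand
that is crossed from right to left increase by one. -/
def IsNumbering (D : GaussCode) (n : D.Arc → ℤ) : Prop :=
  ∀ p, D.crossedToLeft p = true → n p = n (D.prev p) + 1 ∧
    n (D.prev (D.opp p)) = n (D.prev p) + 1 ∧ n (D.opp p) = n (D.prev p)

theorem exists_isNumbering {D : GaussCode} (hD : D.passages ≠ []) (h : D.IsPlanar) :
    ∃ n : D.Arc → ℤ, D.IsNumbering n := by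
  have hF := h.resolve_left hD
  have h1 := D.finrank_range_faceDifference
  have h2 := D.finrank_ker_incidence
  have h3 := D.two_mul_card_crossing
  have h4 := D.card_arc
  have hle : LinearMap.range D.faceDifference ≤
      LinearMap.ker (Matrix.mulVecLin (Matrix.transpose D.incidence)) := by
    rintro _ ⟨f, rfl⟩
    exact LinearMap.mem_ker.2 (vecMul_incidence_eq_zero (D.faceDifference_add_opp f))
  -- With `V - E + F = 2` the two bounds `F - 1` and `E - V + 1` coincide, so every cycle is a
  -- boundary.
  have heq := Submodule.eq_of_le_of_finrank_le hle (by omega)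
  -- The knot run through backwards, as a 1-cycle. The face function bounding it increases by one
  -- from the left to the right of each arc.
  have hmem : (fun _ => -1 : D.Arc → ℚ) ∈ LinearMap.range D.faceDifference := by
    rw [heq]
    exact LinearMap.mem_ker.2 (vecMul_incidence_eq_zero fun p => by simp)
  obtain ⟨f, hf⟩ := hmem
  have hf : ∀ p, f (D.rightFace p) = f (D.leftFace p) + 1 := fun p => by
    have : f (D.leftFace p) - f (D.rightFace p) = -1 := congrFun hf p
    linarith
  have key : ∀ p, D.crossedToLeft p = true →
      f (D.leftFace p) = f (D.leftFace (D.prev p)) + 1 ∧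
      f (D.leftFace (D.prev (D.opp p))) = f (D.leftFace (D.prev p)) + 1 ∧
      f (D.leftFace (D.opp p)) = f (D.leftFace (D.prev p)) := fun p hp =>
    ⟨by rw [← rightFace_opp hp, hf, leftFace_opp hp], by rw [leftFace_prev_opp hp, hf],
      by rw [leftFace_opp hp]⟩
  let p₀ : D.Arc := ⟨D.passages.head hD, List.head_mem hD⟩
  have hfr : ∀ p, Int.fract (f (D.leftFace p)) = Int.fract (f (D.leftFace p₀)) := by
    refine fun p => eq_of_next_eq (g := fun p => Int.fract (f (D.leftFace p))) (fun p => ?_) p p₀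
    by_cases hq : D.crossedToLeft (D.next p) = true
    · have := (key _ hq).1
      rw [prev_next] at this
      simp only [this, Int.fract_add_one]
    · have hk := key (D.opp (D.next p)) (by simpa [crossedToLeft_opp] using hq)
      simp only [opp_opp, prev_next] at hk
      simp only [hk.2.1, hk.2.2, Int.fract_add_one]
  -- The face function is only rational, but rounding down respects equalities and unit steps, which
  -- is all a numbering asks for.
  have hn : ∀ p q, f (D.leftFace p) = f (D.leftFace q) + 1 →
      ⌊f (D.leftFace p)⌋ = ⌊f (D.leftFace q)⌋ + 1 := fun p q h => by rw [h, Int.floor_add_one]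
  exact ⟨fun p => ⌊f (D.leftFace p)⌋, fun p hp => ⟨hn _ _ (key p hp).1, hn _ _ (key p hp).2.1,
    by simp only [(key p hp).2.2]⟩⟩

end GaussCode

/-! ### Vanishing for diagrams with an Alexander numbering -/

namespace GaussCode

/-- The number changes by one at each passage, so it follows the position modulo 2. The two arcs
leaving a crossing have numbers differing by one, so the two positions have different parity. -/
theorem IsNumbering.not_isOddLabel {D : GaussCode} {n : D.Arc → ℤ} (h : D.IsNumbering n)
    (p : D.Arc) : ¬ D.IsOddLabel p.1.label := by
  wlog hp : D.crossedToLeft p = true generalizing p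
  · exact this (D.opp p) (by simpa [crossedToLeft_opp] using hp)
  have hstep : ∀ q, (n (D.next q) - n q) % 2 = 1 := by
    intro q
    by_cases hq : D.crossedToLeft (D.next q) = true
    · have := (h _ hq).1
      rw [prev_next] at this
      omega
    · have := h (D.opp (D.next q)) (by simpa [crossedToLeft_opp] using hq)
      rw [opp_opp, prev_next] at this
      omega
  have key : ∀ i (hi : i < D.passages.length), (n ⟨D.passages[i], List.getElem_mem _⟩ - i) % 2 =
      n ⟨D.passages[0], List.getElem_mem _⟩ % 2 := by
    intro i
    induction i with
    | zero => intro hi; simp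
    | succ i ih =>
      intro hi
      have h1 := ih (by omega)
      have h2 := hstep ⟨D.passages[i], List.getElem_mem _⟩
      rw [next_getElem D i hi] at h2
      push_cast
      omega
  have key' : ∀ q : D.Arc, (n q - D.passages.idxOf q.1) % 2 =
      n ⟨D.passages[0]'(List.length_pos_of_mem p.2), List.getElem_mem _⟩ % 2 := by
    intro q
    have := key (D.passages.idxOf q.1) (List.idxOf_lt_length_of_mem q.2)
    simpa only [List.getElem_idxOf] using this
  have h1 := key' p
  have h2 := key' (D.opp p)
  have h3 := h p hp
  rw [isOddLabel_label_iff D p.2]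
  simp only [opp] at h2 h3
  omega

variable {R : Type*} [CommRing R]

/-- The polynomial vanishes for diagrams with an Alexander numbering. -/
theorem IsNumbering.polynomial_eq_zero {D : GaussCode} {n : D.Arc → ℤ} (h : D.IsNumbering n)
    {B : LinearCrossing R} (hB : B.r = 1 - B.s * B.t) (P : LinearCrossing R) :
    D.polynomial B.matrix P.matrix = 0 := by
  by_cases hD : D.passages = []
  · simp [polynomial, hD]
  rw [polynomial, if_neg hD]
  -- At each crossing two arcs have the number `m` and two have `m + 1`; the relations of `B` then
  -- reduce to `r = 1 - s t`.
  let v : D.Arc → R := fun p => ((B.s ^ n p : Rˣ) : R)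
  have hv : (D.relationMatrix B.matrix P.matrix).mulVec v = 0 := by
    funext p
    have hw : D.weight B P p.1.label = B := by simp [weight, h.not_isOddLabel p]
    have hrow : (D.relationMatrix B.matrix P.matrix).mulVec v p =
        (B.diag p.1.isOver p.1.sign : R) * v (D.prev p) +
          B.mix p.1.isOver p.1.sign * v (D.prev (D.opp p)) - v p := by
      simp only [Matrix.mulVec, dotProduct, relationMatrix, crossingMap_diag, crossingMap_mix, hw,
        sub_mul, add_mul, ite_mul, zero_mul, one_mul, Finset.sum_sub_distrib,
        Finset.sum_add_distrib, Finset.sum_ite_eq', Finset.mem_univ, if_true]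
    rw [hrow, Pi.zero_apply]
    clear hrow hw
    have i1 := B.s.mul_inv
    have i2 := B.t.mul_inv
    by_cases hp : D.crossedToLeft p = true
    · obtain ⟨h1, h2, -⟩ := h p hp
      simp only [v, h1, h2, zpow_add, zpow_one, Units.val_mul]
      generalize ((B.s ^ n (D.prev p) : Rˣ) : R) = y
      obtain ⟨⟨o, a, e⟩, hm⟩ := p
      rcases Int.units_eq_one_or e with rfl | rfl <;> cases o <;>
        simp [crossedToLeft, LinearCrossing.diag, LinearCrossing.mix, hB] at hp ⊢ <;> grind
    · have hq : D.crossedToLeft (D.opp p) = true := by simpa [crossedToLeft_opp] using hp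
      obtain ⟨-, h2, h3⟩ := h _ hq
      rw [opp_opp] at h2 h3
      simp only [v, h2, h3, zpow_add, zpow_one, Units.val_mul]
      generalize ((B.s ^ n (D.prev (D.opp p)) : Rˣ) : R) = y
      obtain ⟨⟨o, a, e⟩, hm⟩ := p
      rcases Int.units_eq_one_or e with rfl | rfl <;> cases o <;>
        simp [crossedToLeft, LinearCrossing.diag, LinearCrossing.mix, hB] at hp ⊢ <;> grind
  -- Multiplying `M v = 0` by the adjugate gives `det M • v = 0`. The entries of `v` are units, so
  -- no assumption on zero divisors is needed.
  have hz : (D.relationMatrix B.matrix P.matrix).det • v = 0 := by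
    rw [← Matrix.one_mulVec v, ← Matrix.smul_mulVec, ← Matrix.adjugate_mul,
      ← Matrix.mulVec_mulVec, hv, Matrix.mulVec_zero]
  have := congrFun hz ⟨D.passages.head hD, List.head_mem hD⟩
  simpa [v] using this

theorem polynomial_congr_of_not_hasOddCrossing {D : GaussCode} (h : ¬ D.HasOddCrossing)
    (B P P' : Matrix (Fin 2) (Fin 2) R) : D.polynomial B P = D.polynomial B P' := by
  have : ∀ p : D.Arc, ¬ Odd (D.termsBetween p.1) := fun p hp => h ⟨p.1, p.2, hp⟩
  have e : D.relationMatrix B P = D.relationMatrix B P' := by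
    ext p x
    simp only [relationMatrix, crossingMap, this p, if_false]
  simp only [polynomial, e]

end GaussCode

/-! ### The three parity pairs -/

namespace ParityAlexander

/-- A monomial as a unit. -/
noncomputable def monomialUnit (i j k : ℤ) : Laurentˣ :=
  ⟨Laurent.monomial i j k, Laurent.monomial (-i) (-j) (-k),
    by simp [Laurent.monomial, AddMonoidAlgebra.single_mul_single, AddMonoidAlgebra.one_def]; rfl,
    by simp [Laurent.monomial, AddMonoidAlgebra.single_mul_single, AddMonoidAlgebra.one_def]; rfl⟩

theorem monomialUnit_mul (i j k i' j' k' : ℤ) :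
    monomialUnit i j k * monomialUnit i' j' k' = monomialUnit (i + i') (j + j') (k + k') := by
  ext1
  simp [monomialUnit, Laurent.monomial, AddMonoidAlgebra.single_mul_single]

theorem monomialUnit_zero : monomialUnit 0 0 0 = 1 := by
  ext1
  rfl

theorem monomialUnit_zpow (i j : ℤ) (m : ℤ) :
    monomialUnit i j 0 ^ m = monomialUnit (m * i) (m * j) 0 := by
  induction m using Int.induction_on with
  | zero => simp [monomialUnit_zero]
  | succ m ih =>
    rw [zpow_add_one, ih, monomialUnit_mul]
    congr 1 <;> ring
  | pred m ih =>
    have h : (monomialUnit i j 0)⁻¹ = monomialUnit (-i) (-j) 0 := by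
      rw [inv_eq_iff_mul_eq_one, monomialUnit_mul]
      simp [monomialUnit_zero]
    rw [zpow_sub_one, ih, h, monomialUnit_mul]
    congr 1 <;> ring

/-- The map of the Generalized Alexander Biquandle. -/
noncomputable def crossingB : LinearCrossing Laurent :=
  ⟨monomialUnit 1 0 0, monomialUnit 0 1 0, 1 - Laurent.s * Laurent.t⟩

noncomputable def crossingP₂ : LinearCrossing Laurent :=
  ⟨monomialUnit 1 0 0, monomialUnit 0 1 0, Laurent.s * Laurent.t - 1⟩

noncomputable def crossingP₃ : LinearCrossing Laurent :=
  ⟨monomialUnit 0 0 1, monomialUnit 0 0 (-1), 0⟩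

theorem monomial_mul_neg :
    (monomialUnit 0 0 (-1) : Laurent) * monomialUnit 0 0 1 = 1 := by
  rw [← Units.val_mul, monomialUnit_mul]
  simp [monomialUnit_zero]

theorem isParityPair_P₁ : IsParityPair crossingB crossingB := by
  have hs : (monomialUnit 1 0 0 : Laurent) = Laurent.s := rfl
  have ht : (monomialUnit 0 1 0 : Laurent) = Laurent.t := rfl
  refine ⟨?_, ⟨?_, ?_, ?_⟩, ⟨?_, ?_, ?_⟩, ⟨?_, ?_, ?_⟩, ⟨?_, ?_, ?_⟩⟩ <;>
    simp only [crossingB, hs, ht] <;> ring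

/-- `P₂` differs from `B` only in the sign of `r`. With two odd crossings that sign is squared away
or appears on both sides of each condition. -/
theorem isParityPair_P₂ : IsParityPair crossingB crossingP₂ := by
  have hs : (monomialUnit 1 0 0 : Laurent) = Laurent.s := rfl
  have ht : (monomialUnit 0 1 0 : Laurent) = Laurent.t := rfl
  refine ⟨?_, ⟨?_, ?_, ?_⟩, ⟨?_, ?_, ?_⟩, ⟨?_, ?_, ?_⟩, ⟨?_, ?_, ?_⟩⟩ <;>
    simp only [crossingB, crossingP₂, hs, ht] <;> ring

theorem isParityPair_P₃ : IsParityPair crossingB crossingP₃ := by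
  have hs : (monomialUnit 1 0 0 : Laurent) = Laurent.s := rfl
  have ht : (monomialUnit 0 1 0 : Laurent) = Laurent.t := rfl
  -- Since `r = 0` for `P₃`, the only condition not trivial by this is the one with `a` and `c` odd,
  -- where `1 - t s` vanishes because `z⁻¹ z = 1`.
  have hz := monomial_mul_neg
  refine ⟨?_, ⟨?_, ?_, ?_⟩, ⟨?_, ?_, ?_⟩, ⟨?_, ?_, ?_⟩, ⟨?_, ?_, ?_⟩⟩ <;>
    simp only [crossingB, crossingP₃, hs, ht, hz] <;> ring

theorem parityPolynomial_of_knot_eq {P : LinearCrossing Laurent} (hP : IsParityPair crossingB P)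
    {D D' : GaussCode} (h : D.knot = D'.knot) :
    Laurent.EqUpToUnit (D'.parityPolynomial P.matrix) (D.parityPolynomial P.matrix) := by
  obtain ⟨k, hk⟩ := GaussCode.polynomial_of_knot_eq hP h
  refine ⟨k, k, hk.trans ?_⟩
  rw [crossingB, monomialUnit_mul, add_zero, zero_add, add_zero, monomialUnit_zpow, mul_one]
  rfl

theorem parityPolynomial_eq_zero {P : LinearCrossing Laurent} (hP : IsParityPair crossingB P)
    {D : GaussCode} (h : D.knot.IsClassical) : D.parityPolynomial P.matrix = 0 := by
  obtain ⟨D₀, h₀, hpl⟩ := h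
  obtain ⟨i, j, hij⟩ := parityPolynomial_of_knot_eq hP h₀
  have hz : D₀.parityPolynomial P.matrix = 0 := by
    by_cases hD : D₀.passages = []
    · simp [GaussCode.parityPolynomial, GaussCode.polynomial, hD]
    · obtain ⟨n, hn⟩ := GaussCode.exists_isNumbering hD hpl
      exact hn.polynomial_eq_zero (B := crossingB) hP.loop P
  rw [hij, hz, mul_zero]

end ParityAlexander

theorem mainTheorem1 (K : VirtualKnot) :
    (∀ P : Matrix (Fin 2) (Fin 2) Laurent,
      (P = ParityAlexander.P₁ ∨ P = ParityAlexander.P₂ ∨ P = ParityAlexander.P₃) →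
      ∀ D : GaussCode, D.knot = K → D.parityPolynomial P ≠ 0 → ¬ K.IsClassical) ∧
    (∀ D₁ D₂ : GaussCode, D₁.knot = K → D₂.knot = K →
      ¬ Laurent.EqUpToUnit (D₁.parityPolynomial ParityAlexander.P₃) D₂.sawollekPolynomial →
      ∀ D : GaussCode, D.knot = K → D.HasOddCrossing) := by
  constructor
  · rintro P hP D rfl hne hcl
    rcases hP with rfl | rfl | rfl
    · exact hne (ParityAlexander.parityPolynomial_eq_zero ParityAlexander.isParityPair_P₁ hcl)
    · exact hne (ParityAlexander.parityPolynomial_eq_zero ParityAlexander.isParityPair_P₂ hcl)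
    · exact hne (ParityAlexander.parityPolynomial_eq_zero ParityAlexander.isParityPair_P₃ hcl)
  · rintro D₁ D₂ h₁ h₂ hne D hD
    by_contra hodd
    -- As `P₁` is `B`, the right side is the Sawollek polynomial of `D`. Invariance of both
    -- polynomials then leads from `D₁` through `D` to `D₂`.
    have e : D.parityPolynomial ParityAlexander.P₃ = D.parityPolynomial ParityAlexander.P₁ :=
      GaussCode.polynomial_congr_of_not_hasOddCrossing hodd _ _ _
    obtain ⟨i, j, h3⟩ := ParityAlexander.parityPolynomial_of_knot_eq
      ParityAlexander.isParityPair_P₃ (hD.trans h₁.symm)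
    obtain ⟨k, l, h4⟩ := ParityAlexander.parityPolynomial_of_knot_eq
      ParityAlexander.isParityPair_P₁ (h₂.trans hD.symm)
    refine hne ⟨i + k, j + l, ?_⟩
    have h5 : D.parityPolynomial ParityAlexander.P₁ =
        Laurent.monomial k l 0 * D₂.sawollekPolynomial := h4
    have h6 : D₁.parityPolynomial ParityAlexander.P₃ =
        Laurent.monomial i j 0 * D.parityPolynomial ParityAlexander.P₃ := h3
    rw [h6, e, h5, ← mul_assoc]
    congr 1
    exact congrArg Units.val (ParityAlexander.monomialUnit_mul i j 0 k l 0)
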